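/- Let $G$ be a locally compact Hausdorff topological group with identity $e$; functions are complex-valued, and a set is relatively compact if its closure is compact. **Function spaces.** $\mathscr{CB}(G)$ is the space of bounded continuous functions with the supremum norm. A bounded function $f$ is in $\mathscr{LUC}(G)$ (respectively, $\mathscr{RUC}(G)$) if for every $\epsilon>0$ there is a neighbourhood $N$ of $e$ with $|f(s)-f(t)|<\epsilon$ whenever $st^{-1}\in N$ (respectively, $s^{-1}t\in N$); $\mathscr{UC}(G)=\mathscr{LUC}(G)\cap\mathscr{RUC}(G)$. $\mathscr{WAP}(G)$ is the algebra of all $f\in\mathscr{CB}(G)$ whose set of left translates $f_s$, $f_s(t)=f(st)$, is relatively weakly compact in $\mathscr{CB}(G)$. A function is supported in $A\subseteq G$ if it vanishes off $A$. **The compactification.** $G^{\mathscr{WAP}}$ is the spectrum of $\mathscr{WAP}(G)$ (the non-zero multiplicative linear functionals, with the weak* topology), with the product $(xy)(f)=x(yf)$, where $(yf)(s)=y(f_s)$. $G$ is identified with its image under $s\mapsto(f\mapsto f(s))$, and $G^*=G^{\mathscr{WAP}}\setminus G$. The continuous extension of $f\in\mathscr{WAP}(G)$ is $f^{\mathscr{WAP}}(x)=x(f)$,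 and $\overline{T}^{\mathscr{WAP}}$ is the closure of $T$ in $G^{\mathscr{WAP}}$. **Sets.** $T\subseteq G$ is an *E-set* if it is not relatively compact and, for each neighbourhood $N$ of $e$, $\bigcap\{t^{-1}Nt:t\in T\cup T^{-1}\}$ is a neighbourhood of $e$; $G$ is an *E-group* if it contains an E-set. $T$ is *right $U$-uniformly discrete* if the sets $Ut$, $t\in T$, are pairwise disjoint. A set $A\subseteq G$ is *translation-compact* if every non-relatively compact $L\subseteq G$ contains finite sets $F,F'$ such that $\bigcap_{b\in F}b^{-1}A$ and $\bigcap_{b\in F'}Ab^{-1}$ are relatively compact. $T$ is a *$\mathscr{WAP}(G)$-interpolation set* if every bounded function on $T$ extends to a function in $\mathscr{WAP}(G)$. It is *approximable* if, in addition, for every neighbourhood $N$ of $e$ there are open neighbourhoods $V_1,V_2$ of $e$ with $\overline{V_1}\subseteq V_2\subseteq N$ such that for each $T_1\subseteq T$ some $h\in\mathscr{WAP}(G)$ is $1$ on $V_1T_1$ and $0$ on $G\setminus V_2T_1$. Put $1_{T,\varphi}(s)=\sum_{t\in T}\varphi(st^{-1})$. **Theorem.** Let $G$ be a locally compact Hausdorff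 E-group, let $T$ be an E-set that is right $U$-uniformly discrete for some neighbourhood $U$ of $e$, and let $V$ be an open, relatively compact neighbourhood of $e$ with $V^2\subseteq U$. The following statements are equivalent. 1. Every function in $\mathscr{UC}(G)$ which is supported in $VT$ is in $\mathscr{WAP}(G)$. 2. $VT$ is translation-compact. 3. For every $\varphi\in\mathscr{UC}(G)$ supported in $V$, the function $1_{T,\varphi}$ is in $\mathscr{WAP}(G)$ and its extension $1_{T,\varphi}^{\mathscr{WAP}}$ is zero on $G^*G^*$. 4. For every open neighbourhood $W$ of $e$ with $W\subseteq V$, the set $W\,\overline{T}^{\mathscr{WAP}}$ is open in $G^{\mathscr{WAP}}$; and $\overline{T}^{\mathscr{WAP}}\subseteq G^{\mathscr{WAP}}\setminus G^*G^*$. 5. $T$ is a $\mathscr{WAP}(G)$-interpolation set; for every $\varphi\in\mathscr{LUC}(G)$ supported in $\overline V$, the function $1_{T,\varphi}$ is in $\mathscr{WAP}(G)$; and $\overline V\,\overline{T}^{\mathscr{WAP}}=\overline V\times\beta T$, that is, the map $(v,t)\mapsto vt$ on $\overline V\times T$ extends to a homeomorphism from $\overline V\times\beta T$ onto $\overline V\,\overline{T}^{\mathscr{WAP}}$,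 where $\beta T$ is the Stone–Čech compactification of $T$. Moreover, $T$ is an approximable $\mathscr{WAP}(G)$-interpolation set if and only if every neighbourhood of $e$ contains an open, relatively compact neighbourhood $V$ of $e$ with $V^2\subseteq U$ for which one (equivalently, all) of the statements 1–5 holds. -/

import Mathlib

open Set Filter
open scoped BoundedContinuousFunction Pointwise Topology

/-! ### Uniformly continuous functions -/

section Functions

variable (G : Type*) [TopologicalSpace G] [Group G]

/-- `LUC(G)`: the bounded functions `f` such that `|f s - f t|` is small as soon as `s * t⁻¹` is close
to the identity (the right uniformly continuous functions). -/
def LUC : Set (G → ℂ) :=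
  {f | (∃ C : ℝ, ∀ s, ‖f s‖ ≤ C) ∧
    ∀ ε : ℝ, 0 < ε → ∃ U ∈ 𝓝 (1 : G), ∀ s t : G, s * t⁻¹ ∈ U → ‖f s - f t‖ < ε}

/-- `RUC(G)`: the bounded functions `f` such that `|f s - f t|` is small as soon as `s⁻¹ * t` is close
to the identity (the left uniformly continuous functions). -/
def RUC : Set (G → ℂ) :=
  {f | (∃ C : ℝ, ∀ s, ‖f s‖ ≤ C) ∧
    ∀ ε : ℝ, 0 < ε → ∃ U ∈ 𝓝 (1 : G), ∀ s t : G, s⁻¹ * t ∈ U → ‖f s - f t‖ < ε}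

/-- `UC(G)`: the bounded functions that are both right and left uniformly continuous. -/
def UC : Set (G → ℂ) := LUC G ∩ RUC G

end Functions

/-! ### Weakly almost periodic functions and the WAP-compactification -/

section WeaklyAlmostPeriodic

variable {G : Type*} [TopologicalSpace G] [Group G] [IsTopologicalGroup G]

/-- The left translate `f_s`, `f_s t = f (s * t)`, as a bounded operator on `CB(G)`. -/
noncomputable def leftTranslate (s : G) : (G →ᵇ ℂ) →L[ℂ] (G →ᵇ ℂ) :=
  LinearMap.mkContinuous
    { toFun := fun f => f.compContinuous ⟨fun t => s * t, continuous_const_mul s⟩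
      map_add' := fun _ _ => rfl
      map_smul' := fun _ _ => rfl } 1
    (fun f => by
      rw [one_mul]
      exact (BoundedContinuousFunction.norm_le (norm_nonneg f)).2 fun t => f.norm_coe_le_norm _)

@[simp] theorem leftTranslate_apply (s : G) (f : G →ᵇ ℂ) (t : G) :
    leftTranslate s f t = f (s * t) := rfl

theorem leftTranslate_leftTranslate (s t : G) (f : G →ᵇ ℂ) :
    leftTranslate s (leftTranslate t f) = leftTranslate (t * s) f := by
  ext u
  simp [mul_assoc]

/-- The set of left translates of `f`, as a subset of `CB(G)` with its weak topology. -/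
noncomputable def weakOrbit (f : G →ᵇ ℂ) : Set (WeakSpace ℂ (G →ᵇ ℂ)) :=
  range fun s : G => toWeakSpace ℂ (G →ᵇ ℂ) (leftTranslate s f)

/-- `f` is weakly almost periodic: its left translates form a relatively weakly compact subset of
`CB(G)`. -/
def IsWAP (f : G →ᵇ ℂ) : Prop := IsCompact (closure (weakOrbit f))

set_option linter.unusedSectionVars false in
/-- Functionals separate points, so the weak topology is Hausdorff. -/
theorem t2Space_weakSpace : T2Space (WeakSpace ℂ (G →ᵇ ℂ)) := by
  refine ⟨fun x y hxy => ?_⟩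
  have h : ∃ ℓ : StrongDual ℂ (G →ᵇ ℂ), ℓ x ≠ ℓ y := by
    by_contra! hc
    exact hxy ((SeparatingDual.eq_iff_forall_dual_eq (R := ℂ) (V := G →ᵇ ℂ)).2 hc)
  obtain ⟨ℓ, hℓ⟩ := h
  exact separated_by_continuous (WeakBilin.eval_continuous _ ℓ) hℓ

theorem IsWAP.of_subset {f : G →ᵇ ℂ} {K : Set (WeakSpace ℂ (G →ᵇ ℂ))} (hK : IsCompact K)
    (h : weakOrbit f ⊆ K) : IsWAP f := by
  have := t2Space_weakSpace (G := G)
  exact hK.closure_of_subset h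

variable (G) in
/-- The space `WAP(G)` of weakly almost periodic functions, a subspace of `CB(G)`. -/
noncomputable def WAP : Submodule ℂ (G →ᵇ ℂ) where
  carrier := {f | IsWAP f}
  zero_mem' := IsWAP.of_subset (K := {0}) isCompact_singleton (by
    rintro _ ⟨s, rfl⟩
    simp)
  add_mem' := by
    intro f g hf hg
    refine IsWAP.of_subset (K := closure (weakOrbit f) + closure (weakOrbit g)) (hf.add hg) ?_
    rintro _ ⟨s, rfl⟩
    refine ⟨_, subset_closure ⟨s, rfl⟩, _, subset_closure ⟨s, rfl⟩, ?_⟩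
    simp
  smul_mem' := by
    intro c f hf
    refine IsWAP.of_subset (K := (fun x => c • x) '' closure (weakOrbit f))
      (hf.image (continuous_const_smul c)) ?_
    rintro _ ⟨s, rfl⟩
    refine ⟨_, subset_closure ⟨s, rfl⟩, ?_⟩
    simp

theorem weakOrbit_subset_of_mem_closure {f g : G →ᵇ ℂ}
    (hg : toWeakSpace ℂ (G →ᵇ ℂ) g ∈ closure (weakOrbit f)) :
    weakOrbit g ⊆ closure (weakOrbit f) := by
  rintro _ ⟨s, rfl⟩
  have hm : MapsTo (WeakSpace.map (leftTranslate (G := G) s)) (weakOrbit f) (weakOrbit f) := by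
    rintro _ ⟨t, rfl⟩
    exact ⟨t * s, (leftTranslate_leftTranslate s t f).symm⟩
  exact hm.closure (WeakSpace.map (leftTranslate (G := G) s)).continuous hg

theorem mem_WAP_of_mem_closure {f g : G →ᵇ ℂ} (hf : f ∈ WAP G)
    (hg : toWeakSpace ℂ (G →ᵇ ℂ) g ∈ closure (weakOrbit f)) : g ∈ WAP G :=
  IsWAP.of_subset hf (weakOrbit_subset_of_mem_closure hg)

theorem leftTranslate_mem_WAP (s : G) {f : G →ᵇ ℂ} (hf : f ∈ WAP G) : leftTranslate s f ∈ WAP G :=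
  mem_WAP_of_mem_closure hf (subset_closure ⟨s, rfl⟩)

theorem one_mem_WAP : (1 : G →ᵇ ℂ) ∈ WAP G :=
  IsWAP.of_subset (K := {toWeakSpace ℂ (G →ᵇ ℂ) 1}) isCompact_singleton (by
    rintro _ ⟨s, rfl⟩
    rfl)

/-- The left translate `f_s` of `f` in `WAP(G)`. -/
noncomputable def WAP.translate (s : G) (f : WAP G) : WAP G :=
  ⟨leftTranslate s f, leftTranslate_mem_WAP s f.2⟩

theorem WAP.norm_translate_le (s : G) (f : WAP G) : ‖WAP.translate s f‖ ≤ ‖f‖ :=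
  (BoundedContinuousFunction.norm_le (norm_nonneg (f : G →ᵇ ℂ))).2 fun _ =>
    (f : G →ᵇ ℂ).norm_coe_le_norm _

theorem WAP.continuous_translate (f : WAP G) :
    Continuous fun s : G => toWeakSpace ℂ (G →ᵇ ℂ) (leftTranslate s f) := by
  have : CompactSpace (closure (weakOrbit (f : G →ᵇ ℂ))) := isCompact_iff_compactSpace.1 f.2
  let e : closure (weakOrbit (f : G →ᵇ ℂ)) → (G → ℂ) :=
    fun g t => ((toWeakSpace ℂ (G →ᵇ ℂ)).symm g.1) t
  have he : Continuous e := by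
    refine continuous_pi fun t => ?_
    exact (WeakBilin.eval_continuous (topDualPairing ℂ (G →ᵇ ℂ)).flip
      (BoundedContinuousFunction.evalCLM ℂ t)).comp continuous_subtype_val
  have hinj : Function.Injective e := by
    intro g h hgh
    refine Subtype.ext ((toWeakSpace ℂ (G →ᵇ ℂ)).symm.injective ?_)
    ext t
    exact congrFun hgh t
  have hemb := (he.isClosedEmbedding hinj).isEmbedding
  let o : G → closure (weakOrbit (f : G →ᵇ ℂ)) := fun s => ⟨_, subset_closure ⟨s, rfl⟩⟩
  have ho : Continuous o := by
    rw [hemb.continuous_iff]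
    refine continuous_pi fun t => ?_
    exact (f : G →ᵇ ℂ).continuous.comp (continuous_mul_const t)
  exact continuous_subtype_val.comp ho

/-- For a functional `y` on `WAP(G)` and `f` in `WAP(G)`, the function `y f`, `(y f) s = y (f_s)`, as
an element of `CB(G)`. -/
noncomputable def WAP.introvertFun (y : StrongDual ℂ (WAP G)) (f : WAP G) : G →ᵇ ℂ :=
  BoundedContinuousFunction.ofNormedAddCommGroup (fun s => y (WAP.translate s f))
    (by
      obtain ⟨m, hm, -⟩ := exists_extension_norm_eq (WAP G) y
      have h : (fun s : G => y (WAP.translate s f)) = fun s => m (leftTranslate s f) :=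
        funext fun s => (hm _).symm
      rw [h]
      exact (WeakBilin.eval_continuous (topDualPairing ℂ (G →ᵇ ℂ)).flip m).comp
        (WAP.continuous_translate f))
    (‖y‖ * ‖f‖)
    (fun s => (y.le_opNorm _).trans
      (mul_le_mul_of_nonneg_left (WAP.norm_translate_le s f) (norm_nonneg y)))

/-- `f ↦ y f` as a bounded operator from `WAP(G)` to `CB(G)`. -/
noncomputable def WAP.introvertCLM (y : StrongDual ℂ (WAP G)) : WAP G →L[ℂ] (G →ᵇ ℂ) :=
  LinearMap.mkContinuous
    { toFun := WAP.introvertFun y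
      map_add' := fun f g => by
        ext s
        exact y.map_add (WAP.translate s f) (WAP.translate s g)
      map_smul' := fun c f => by
        ext s
        exact y.map_smul c (WAP.translate s f) } ‖y‖
    (fun f => (BoundedContinuousFunction.norm_le (mul_nonneg (norm_nonneg y) (norm_nonneg f))).2
      fun s => (y.le_opNorm (WAP.translate s f)).trans
        (mul_le_mul_of_nonneg_left (WAP.norm_translate_le s f) (norm_nonneg y)))

@[simp] theorem WAP.introvertCLM_apply (y : StrongDual ℂ (WAP G)) (f : WAP G) (s : G) :
    WAP.introvertCLM y f s = y (WAP.translate s f) := rfl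

theorem WAP.introvert_mem (y : StrongDual ℂ (WAP G)) (f : WAP G) :
    WAP.introvertCLM y f ∈ WAP G := by
  have : CompactSpace (closure (weakOrbit (f : G →ᵇ ℂ))) := isCompact_iff_compactSpace.1 f.2
  let Ψ : closure (weakOrbit (f : G →ᵇ ℂ)) → WeakSpace ℂ (G →ᵇ ℂ) := fun g =>
    toWeakSpace ℂ (G →ᵇ ℂ)
      (WAP.introvertCLM y ⟨(toWeakSpace ℂ (G →ᵇ ℂ)).symm g.1, mem_WAP_of_mem_closure f.2 g.2⟩)
  have hΨ : Continuous Ψ := by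
    refine WeakBilin.continuous_of_continuous_eval _ fun ℓ => ?_
    obtain ⟨m, hm, -⟩ := exists_extension_norm_eq (WAP G)
      ((ℓ : StrongDual ℂ (G →ᵇ ℂ)).comp (WAP.introvertCLM y))
    have h : Continuous fun g : closure (weakOrbit (f : G →ᵇ ℂ)) =>
        m ((toWeakSpace ℂ (G →ᵇ ℂ)).symm g.1) :=
      (WeakBilin.eval_continuous (topDualPairing ℂ (G →ᵇ ℂ)).flip m).comp continuous_subtype_val
    refine h.congr fun g => ?_
    exact hm ⟨(toWeakSpace ℂ (G →ᵇ ℂ)).symm g.1, mem_WAP_of_mem_closure f.2 g.2⟩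
  refine IsWAP.of_subset (isCompact_range hΨ) ?_
  rintro _ ⟨s, rfl⟩
  refine ⟨⟨_, subset_closure ⟨s, rfl⟩⟩, congrArg (toWeakSpace ℂ (G →ᵇ ℂ)) ?_⟩
  ext t
  refine congrArg y (Subtype.ext ?_)
  exact leftTranslate_leftTranslate t s f

/-- The function `y f`, `(y f) s = y (f_s)`, as an element of `WAP(G)`. -/
noncomputable def WAP.introvert (y : StrongDual ℂ (WAP G)) (f : WAP G) : WAP G :=
  ⟨WAP.introvertCLM y f, WAP.introvert_mem y f⟩

variable (G) in
/-- The WAP-compactification `G^WAP`: the non-zero multiplicative (continuous) linear functionals on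
`WAP(G)`. Multiplicativity is imposed on all `f`, `g` in `WAP(G)` whose product `f * g` is in
`WAP(G)`, which in fact is so for all `f` and `g`; continuity is automatic for such functionals. -/
def GWAP : Type _ :=
  {x : WeakDual ℂ (WAP G) // x ≠ 0 ∧
    ∀ f g h : WAP G, (h : G →ᵇ ℂ) = (f : G →ᵇ ℂ) * (g : G →ᵇ ℂ) → x h = x f * x g}

namespace GWAP

/-- The topology of pointwise convergence on `WAP(G)` (the weak* topology). -/
noncomputable instance : TopologicalSpace (GWAP G) := instTopologicalSpaceSubtype

/-- The value at `x` of the continuous extension `f^WAP` of `f` to `G^WAP`, that is `x f`. -/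
noncomputable def extend (f : WAP G) (x : GWAP G) : ℂ := x.1 f

theorem map_one (x : GWAP G) : x.1 ⟨1, one_mem_WAP⟩ = 1 := by
  obtain ⟨f, hf⟩ := DFunLike.ne_iff.1 x.2.1
  have h := x.2.2 f ⟨1, one_mem_WAP⟩ f (mul_one _).symm
  exact mul_left_cancel₀ hf (by rw [← h, mul_one])

/-- The canonical map `G → G^WAP`, given by evaluations. -/
noncomputable def eval (g : G) : GWAP G :=
  ⟨StrongDual.toWeakDual ((BoundedContinuousFunction.evalCLM ℂ g).comp (WAP G).subtypeL), by
    constructor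
    · intro h
      have h1 := DFunLike.congr_fun h (⟨1, one_mem_WAP⟩ : WAP G)
      exact one_ne_zero (α := ℂ) h1
    · intro f₁ f₂ f₃ h
      exact DFunLike.congr_fun h g⟩

/-- The product of `G^WAP`: `(x y) f = x (y f)`, where `(y f) s = y (f_s)`. -/
noncomputable instance : Mul (GWAP G) where
  mul x y :=
    ⟨StrongDual.toWeakDual ((WeakDual.toStrongDual x.1).comp
        ((WAP.introvertCLM (WeakDual.toStrongDual y.1)).codRestrict (WAP G)
          (WAP.introvert_mem (WeakDual.toStrongDual y.1)))), by
      constructor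
      · intro h
        have h1 := DFunLike.congr_fun h (⟨1, one_mem_WAP⟩ : WAP G)
        have h2 : WAP.introvert (WeakDual.toStrongDual y.1) ⟨1, one_mem_WAP⟩
            = (⟨1, one_mem_WAP⟩ : WAP G) := by
          refine Subtype.ext ?_
          ext s
          exact map_one y
        have h3 : x.1 (WAP.introvert (WeakDual.toStrongDual y.1) ⟨1, one_mem_WAP⟩) = 0 := h1
        rw [h2, map_one x] at h3
        exact one_ne_zero h3
      · intro f₁ f₂ f₃ h
        refine x.2.2 (WAP.introvert _ f₁) (WAP.introvert _ f₂) (WAP.introvert _ f₃) ?_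
        ext s
        refine y.2.2 (WAP.translate s f₁) (WAP.translate s f₂) (WAP.translate s f₃) ?_
        ext t
        exact DFunLike.congr_fun h (s * t)⟩

theorem mul_apply (x y : GWAP G) (f : WAP G) :
    (x * y).1 f = x.1 (WAP.introvert (WeakDual.toStrongDual y.1) f) := rfl

theorem eval_mul (g h : G) : (eval (g * h) : GWAP G) = eval g * eval h := rfl

variable (G) in
/-- The remainder `G* = G^WAP \ G`. -/
def remainder : Set (GWAP G) := (range (eval : G → GWAP G))ᶜ

end GWAP

variable (G) in
/-- The weakly almost periodic functions on `G`, as plain functions. -/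
def WAPFun : Set (G → ℂ) := {f | ∃ h : WAP G, ∀ s, (h : G →ᵇ ℂ) s = f s}

end WeaklyAlmostPeriodic

/-! ### Interpolation sets, translation-compact sets, uniformly discrete sets, E-sets -/

section Sets

variable {G : Type*} [TopologicalSpace G] [Group G]

/-- `T` is an `A`-interpolation set: every bounded function on `T` extends to a function in `A`. -/
def IsInterpolationSet (A : Set (G → ℂ)) (T : Set G) : Prop :=
  ∀ f : T → ℂ, (∃ C : ℝ, ∀ t, ‖f t‖ ≤ C) → ∃ F ∈ A, ∀ t : T, F t = f t

/-- `T` is an approximable `A`-interpolation set. -/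
def IsApproximableInterpolationSet (A : Set (G → ℂ)) (T : Set G) : Prop :=
  IsInterpolationSet A T ∧
    ∀ U ∈ 𝓝 (1 : G), ∃ V₁ V₂ : Set G, IsOpen V₁ ∧ (1 : G) ∈ V₁ ∧ IsOpen V₂ ∧ (1 : G) ∈ V₂ ∧
      closure V₁ ⊆ V₂ ∧ V₂ ⊆ U ∧
      ∀ T₁ ⊆ T, ∃ h ∈ A, (∀ s ∈ V₁ * T₁, h s = 1) ∧ ∀ s ∉ V₂ * T₁, h s = 0

/-- `A` is relatively compact. -/
def RelativelyCompact (A : Set G) : Prop := IsCompact (closure A)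

/-- Every non-relatively compact set `L` contains a finite set `F` such that the intersection of the
sets `b⁻¹T`, `b ∈ F`, is relatively compact. -/
def RightTranslationCompact (T : Set G) : Prop :=
  ∀ L : Set G, ¬ RelativelyCompact L →
    ∃ F : Finset G, (F : Set G) ⊆ L ∧ RelativelyCompact (⋂ b ∈ F, {b⁻¹} * T)

/-- Every non-relatively compact set `L` contains a finite set `F` such that the intersection of the
sets `Tb⁻¹`, `b ∈ F`, is relatively compact. -/
def LeftTranslationCompact (T : Set G) : Prop :=
  ∀ L : Set G, ¬ RelativelyCompact L →
    ∃ F : Finset G, (F : Set G) ⊆ L ∧ RelativelyCompact (⋂ b ∈ F, T * {b⁻¹})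

/-- `T` is translation-compact: both left and right translation-compact. -/
def TranslationCompact (T : Set G) : Prop :=
  LeftTranslationCompact T ∧ RightTranslationCompact T

/-- `T` is right `U`-uniformly discrete: the sets `Us`, `s ∈ T`, are pairwise disjoint. -/
def RightUniformlyDiscrete (U T : Set G) : Prop :=
  ∀ s ∈ T, ∀ t ∈ T, s ≠ t → Disjoint (U * {s}) (U * {t})

/-- An E-set: a non-relatively compact set `T` such that, for every neighbourhood `U` of the identity,
the intersection of the sets `t⁻¹Ut`, `t ∈ T ∪ T⁻¹`, is a neighbourhood of the identity. -/
def IsESet (T : Set G) : Prop :=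
  ¬ RelativelyCompact T ∧
    ∀ U ∈ 𝓝 (1 : G), (⋂ t ∈ T ∪ T⁻¹, {t⁻¹} * U * {t}) ∈ 𝓝 (1 : G)

variable (G) in
/-- An E-group: a group that contains an E-set (in particular, it is not compact). -/
def IsEGroup : Prop := ∃ T : Set G, IsESet T

/-- The function `1_{T,φ}`, with value `∑ t ∈ T, φ (s * t⁻¹)` at `s`. Where it is used, `T` is right
`U`-uniformly discrete and `φ` vanishes off `U`, so that at most one term is non-zero. -/
noncomputable def oneTranslate (T : Set G) (φ : G → ℂ) (s : G) : ℂ := ∑ᶠ t ∈ T, φ (s * t⁻¹)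

end Sets

/-! ### The five conditions -/

section Conditions

variable {G : Type*} [TopologicalSpace G] [Group G] [IsTopologicalGroup G]

/-- Every function in `UC(G)` which is supported in `VT` is in `WAP(G)`. -/
def CondUC (T V : Set G) : Prop :=
  ∀ f ∈ UC G, Function.support f ⊆ V * T → f ∈ WAPFun G

/-- `VT` is translation-compact. -/
def CondTranslationCompact (T V : Set G) : Prop := TranslationCompact (V * T)

/-- For every `φ` in `UC(G)` supported in `V`, the function `1_{T,φ}` is in `WAP(G)` and its extension
to `G^WAP` vanishes on `G*G*`. -/
def CondVanish (T V : Set G) : Prop :=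
  ∀ φ ∈ UC G, Function.support φ ⊆ V →
    ∃ h : WAP G, (∀ s, (h : G →ᵇ ℂ) s = oneTranslate T φ s) ∧
      ∀ x ∈ GWAP.remainder G * GWAP.remainder G, GWAP.extend h x = 0

/-- For every open neighbourhood `W ⊆ V` of the identity, the product of `W` with the closure of `T` in
`G^WAP` is open in `G^WAP`; and this closure does not meet `G*G*`. -/
def CondOpen (T V : Set G) : Prop :=
  (∀ W : Set G, IsOpen W → (1 : G) ∈ W → W ⊆ V →
      IsOpen ((GWAP.eval '' W) * closure (GWAP.eval '' T) : Set (GWAP G))) ∧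
    closure (GWAP.eval '' T) ⊆ (GWAP.remainder G * GWAP.remainder G)ᶜ

/-- `T` is a `WAP(G)`-interpolation set, `1_{T,φ}` is in `WAP(G)` for every `φ` in `LUC(G)` supported in
the closure of `V`, and `(v, t) ↦ vt` extends to a homeomorphism from the product of the closure of
`V` with `βT` onto the product of the closure of `V` with the closure of `T` in `G^WAP`. -/
def CondProduct (T V : Set G) : Prop :=
  IsInterpolationSet (WAPFun G) T ∧
    (∀ φ ∈ LUC G, Function.support φ ⊆ closure V → oneTranslate T φ ∈ WAPFun G) ∧
    ∃ Θ : (closure V × StoneCech T) ≃ₜ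
        ((GWAP.eval '' closure V) * closure (GWAP.eval '' T) : Set (GWAP G)),
      ∀ (v : closure V) (t : T),
        (Θ (v, stoneCechUnit t) : GWAP G) = GWAP.eval ((v : G) * (t : G))

/-- The list of the five conditions. -/
def wapConditions (T V : Set G) : List Prop :=
  [CondUC T V, CondTranslationCompact T V, CondVanish T V, CondOpen T V, CondProduct T V]

/-- `V` is an open, relatively compact neighbourhood of the identity with `V² ⊆ U`. -/
def Admissible (U V : Set G) : Prop :=
  IsOpen V ∧ (1 : G) ∈ V ∧ RelativelyCompact V ∧ V * V ⊆ U

end Conditions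

/-! ### Thin families of finite sets and Pták's lemma -/

/-! Translation-compactness of `V * T` is the hub of the equivalences, and ultrafilters on `G` are
the language. A pair of ultrafilters `q`, `p` has two products, `mulL q p` and `mulR q p`, which
encode the two iterated limits of `f (s * t)`. Grothendieck's criterion (`mem_WAP_iff`) says that a
bounded continuous function is weakly almost periodic exactly when the two limits always agree. A
set is translation-compact exactly when it belongs to neither product of any two free ultrafilters
(`translationCompact_iff`). Every point of `G^WAP` is a limit along an ultrafilter, and the points
of `G*` are those of the free ones.

From 2 to the other statements: a function in `UC(G)` supported in a translation-compact set is
weakly almost periodic (`UC.exists_mem_WAP`). Along free ultrafilters both limits vanish, and along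
a convergent one uniform continuity exchanges them. The E-set condition makes the functions `∑ c t *
φ (s * t⁻¹)` uniformly continuous, so they are available in `WAP(G)`. They vanish on `G*G*`, their
non-vanishing sets give the open sets of 4, and they separate the points of `closure V × βT`.

Back to 2: under 3 or 4, the closure of `T` misses `G*G*`. A product of free ultrafilters containing
`V * T` would represent a point `v y` with `y` in this closure, and translating by `v⁻¹` would put
`y` in `G*G*`. Under 1, 5 or approximability, weakly almost periodic functions separate
neighbourhoods of subsets `T₁` of `T` from the complement of a thickening of `T₁`. If `V * T` were
not translation-compact, a diagonal construction would give a double sequence lying in `V * T` above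
the diagonal and far from those entries below it. A separating function then has different iterated
limits (`translationCompact_of_separation`).

Two analytic facts support this. The hard half of Grothendieck's criterion upgrades pointwise
convergence on `βG` to weak convergence, by Pták's lemma on convex means. Uniform continuity of
weakly almost periodic functions comes from a Baire argument on separable subgroups, and it makes
the action of `G` on `G^WAP` jointly continuous. -/

section Thin

/-- The traces `F` above some `n ≤ m` of the members `insert n F` of `𝒜`. -/
def links (𝒜 : Set (Finset ℕ)) (m : ℕ) : Set (Finset ℕ) :=
  {F | ∃ n ≤ m, (∀ k ∈ F, n < k) ∧ insert n F ∈ 𝒜}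

/-- The traces `F` above `n` of the members `insert n F` of `𝒜`. -/
def link (𝒜 : Set (Finset ℕ)) (n : ℕ) : Set (Finset ℕ) :=
  {F | (∀ k ∈ F, n < k) ∧ insert n F ∈ 𝒜}

/-- Well-founded families of finite sets of natural numbers. -/
inductive Thin : Set (Finset ℕ) → Prop
  | small {𝒜 : Set (Finset ℕ)} (h : 𝒜 ⊆ {∅}) : Thin 𝒜
  -- The traces above all `n ≤ m` are taken together: the averaging in Pták's lemma needs one convex
  -- combination that works for every possible first element up to `m`.
  | step {𝒜 : Set (Finset ℕ)} (h : ∀ m, Thin (links 𝒜 m)) : Thin 𝒜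

theorem links_union (𝒜 ℬ : Set (Finset ℕ)) (m : ℕ) :
    links (𝒜 ∪ ℬ) m = links 𝒜 m ∪ links ℬ m := by
  ext F
  simp only [links, mem_ofPred_eq, mem_union]
  constructor
  · rintro ⟨n, hn, h, h' | h'⟩
    exacts [Or.inl ⟨n, hn, h, h'⟩, Or.inr ⟨n, hn, h, h'⟩]
  · rintro (⟨n, hn, h, h'⟩ | ⟨n, hn, h, h'⟩)
    exacts [⟨n, hn, h, Or.inl h'⟩, ⟨n, hn, h, Or.inr h'⟩]

theorem links_eq_empty {𝒜 : Set (Finset ℕ)} (h : 𝒜 ⊆ {∅}) (m : ℕ) : links 𝒜 m = ∅ := by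
  rw [eq_empty_iff_forall_notMem]
  rintro F ⟨n, -, -, h'⟩
  exact Finset.insert_ne_empty _ _ (h h')

theorem thin_links {𝒜 : Set (Finset ℕ)} (h : Thin 𝒜) (m : ℕ) : Thin (links 𝒜 m) := by
  cases h with
  | small h => exact Thin.small (by rw [links_eq_empty h]; exact empty_subset _)
  | step h => exact h m

theorem Thin.union {𝒜 ℬ : Set (Finset ℕ)} (hA : Thin 𝒜) (hB : Thin ℬ) : Thin (𝒜 ∪ ℬ) := by
  induction hA generalizing ℬ with
  | small h =>
    induction hB with
    | small h' => exact Thin.small (union_subset h h')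
    | step h' ih =>
      refine Thin.step fun m => ?_
      rw [links_union, links_eq_empty h, empty_union]
      exact h' m
  | step h ih =>
    refine Thin.step fun m => ?_
    rw [links_union]
    exact ih m (thin_links hB m)

/-- Passing from `m` to `m + 1` adds a single `link` to `links`, so stability of thinness under
unions suffices. -/
theorem thin_links_of_link {𝒜 : Set (Finset ℕ)} (h : ∀ n, Thin (link 𝒜 n)) (m : ℕ) :
    Thin (links 𝒜 m) := by
  induction m with
  | zero =>
    convert h 0 using 1
    ext F
    simp [links, link]
  | succ m ih =>
    convert ih.union (h (m + 1)) using 1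
    ext F
    simp only [links, link, mem_ofPred_eq, mem_union]
    constructor
    · rintro ⟨n, hn, h, h'⟩
      rcases Nat.le_succ_iff.1 hn with hn | rfl
      exacts [Or.inl ⟨n, hn, h, h'⟩, Or.inr ⟨h, h'⟩]
    · rintro (⟨n, hn, h, h'⟩ | ⟨h, h'⟩)
      exacts [⟨n, hn.trans (Nat.le_succ _), h, h'⟩, ⟨m + 1, le_rfl, h, h'⟩]

/-- A hereditary family which is not thin contains all finite subsets of an infinite set. -/
theorem exists_strictMono_of_not_thin {𝒜 : Set (Finset ℕ)}
    (hA : ∀ F ∈ 𝒜, ∀ F' ⊆ F, F' ∈ 𝒜) (h : ¬ Thin 𝒜) :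
    ∃ n : ℕ → ℕ, StrictMono n ∧ ∀ k, (Finset.range k).image n ∈ 𝒜 := by
  -- A family that is not thin has a link that is not thin. Iterating this choice produces the
  -- elements of the infinite set one by one.
  have hstep : ∀ ℬ : {ℬ : Set (Finset ℕ) // ¬ Thin ℬ}, ∃ n, ¬ Thin (link ℬ.1 n) := by
    rintro ⟨ℬ, hB⟩
    by_contra! hc
    exact hB (Thin.step (thin_links_of_link hc))
  choose c hc using hstep
  let b : ℕ → {ℬ : Set (Finset ℕ) // ¬ Thin ℬ} := fun k =>
    Nat.rec ⟨𝒜, h⟩ (fun _ ℬ => ⟨link ℬ.1 (c ℬ), hc ℬ⟩) k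
  have hb : ∀ k, (b (k + 1)).1 = link (b k).1 (c (b k)) := fun k => rfl
  have hne : ∀ k, ∃ F, F ∈ (b k).1 := by
    intro k
    by_contra! hcon
    exact (b k).2 (Thin.small fun F hF => absurd hF (hcon F))
  have hunion : ∀ k, ∀ F ∈ (b k).1, F ∪ (Finset.range k).image (fun i => c (b i)) ∈ 𝒜 := by
    intro k
    induction k with
    | zero =>
      intro F hF
      have hF' : F ∈ 𝒜 := hF
      simpa using hF'
    | succ k ih =>
      intro F hF
      rw [hb] at hF
      have := ih _ hF.2
      rwa [Finset.range_add_one, Finset.image_insert, Finset.union_insert, ← Finset.insert_union]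
  refine ⟨fun k => c (b k), strictMono_nat_of_lt_succ fun k => ?_, fun k => ?_⟩
  · obtain ⟨F, hF⟩ := hne (k + 2)
    rw [hb (k + 1)] at hF
    have h2 := hF.2
    rw [hb k] at h2
    exact h2.1 _ (Finset.mem_insert_self _ _)
  · obtain ⟨F, hF⟩ := hne k
    exact hA _ (hunion k F hF) _ Finset.subset_union_right

/-- **Pták's combinatorial lemma**: there are convex combinations which are small on all members of a
thin hereditary family. -/
theorem Thin.exists_convex {𝒜 : Set (Finset ℕ)} (h : Thin 𝒜)
    (hA : ∀ F ∈ 𝒜, ∀ F' ⊆ F, F' ∈ 𝒜) {δ : ℝ} (hδ : 0 < δ) (N : ℕ) :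
    ∃ (S : Finset ℕ) (w : ℕ → ℝ), (∀ n ∈ S, N ≤ n) ∧ (∀ n ∉ S, w n = 0) ∧ (∀ n, 0 ≤ w n) ∧
      ∑ n ∈ S, w n = 1 ∧ ∀ F ∈ 𝒜, ∑ n ∈ F, w n ≤ δ := by
  induction h generalizing δ N with
  | small h =>
    refine ⟨{N}, Pi.single N 1, by simp, fun n hn => ?_, fun n => ?_, by simp, fun F hF => ?_⟩
    · simp only [Finset.mem_singleton] at hn
      simp [hn]
    · by_cases h : n = N
      · subst h; simp
      · simp [h]
    · rw [h hF]
      simpa using hδ.le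
  | @step 𝒜 h ih =>
    have hlinks : ∀ m, ∀ F ∈ links 𝒜 m, ∀ F' ⊆ F, F' ∈ links 𝒜 m := by
      rintro m F ⟨n, hn, h1, h2⟩ F' hF
      exact ⟨n, hn, fun k hk => h1 k (hF hk), hA _ h2 _ (Finset.insert_subset_insert _ hF)⟩
    -- Add `k` unit masses, each supported beyond the previous ones. A member `F` of `𝒜` can collect
    -- mass `1` from the first block that it meets. After that its tail lies in `links`, so each
    -- later block contributes at most `δ / 2`.
    have key : ∀ k : ℕ, ∃ (S : Finset ℕ) (w : ℕ → ℝ), (∀ n ∈ S, N ≤ n) ∧ (∀ n ∉ S, w n = 0) ∧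
        (∀ n, 0 ≤ w n) ∧ ∑ n ∈ S, w n = k ∧ ∀ F ∈ 𝒜, ∑ n ∈ F, w n ≤ 1 + k * (δ / 2) := by
      intro k
      induction k with
      | zero => exact ⟨∅, 0, by simp⟩
      | succ k ihk =>
        obtain ⟨S, w, hS, hw, hw0, hsum, hF⟩ := ihk
        obtain ⟨S', w', hS', hw', hw0', hsum', hF'⟩ :=
          ih (S.sup id) (hlinks _) (half_pos hδ) (max N (S.sup id + 1))
        have hle : ∀ F : Finset ℕ, ∑ n ∈ F, w' n ≤ 1 := by
          intro F
          rw [← hsum', ← Finset.sum_filter_add_sum_filter_not F (· ∈ S'),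
            Finset.sum_eq_zero (s := F.filter (· ∉ S'))
              (fun n hn => hw' n (Finset.mem_filter.1 hn).2), add_zero]
          exact Finset.sum_le_sum_of_subset_of_nonneg
            (fun n hn => (Finset.mem_filter.1 hn).2) (fun n _ _ => hw0' n)
        refine ⟨S ∪ S', w + w', ?_, ?_, fun n => add_nonneg (hw0 n) (hw0' n), ?_, ?_⟩
        · intro n hn
          rcases Finset.mem_union.1 hn with hn | hn
          exacts [hS n hn, (le_max_left _ _).trans (hS' n hn)]
        · intro n hn
          rw [Finset.mem_union, not_or] at hn
          simp [hw n hn.1, hw' n hn.2]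
        · simp only [Pi.add_apply, Finset.sum_add_distrib]
          rw [← Finset.sum_subset Finset.subset_union_left (fun n _ hn => hw n hn),
            ← Finset.sum_subset Finset.subset_union_right (fun n _ hn => hw' n hn), hsum, hsum']
          push_cast
          ring
        · intro F hFA
          simp only [Pi.add_apply, Finset.sum_add_distrib]
          by_cases hd : ∃ n ∈ F, n ∈ S
          · obtain ⟨n, hnF, hnS⟩ := hd
            have hn : n ≤ S.sup id := Finset.le_sup (f := id) hnS
            have h1 : F.filter (n < ·) ∈ links 𝒜 (S.sup id) := by
              refine ⟨n, hn, fun k hk => (Finset.mem_filter.1 hk).2, hA F hFA _ ?_⟩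
              exact Finset.insert_subset hnF (Finset.filter_subset _ _)
            have h2 : ∑ i ∈ F, w' i = ∑ i ∈ F.filter (n < ·), w' i := by
              refine (Finset.sum_subset (Finset.filter_subset _ _) fun i hi hi' => ?_).symm
              refine hw' i fun hiS => hi' (Finset.mem_filter.2 ⟨hi, ?_⟩)
              exact lt_of_lt_of_le (Nat.lt_succ_of_le hn) ((le_max_right _ _).trans (hS' i hiS))
            have h3 := hF' _ h1
            have h4 := hF F hFA
            rw [h2]
            push_cast
            linarith
          · have h1 : ∑ i ∈ F, w i = 0 :=
              Finset.sum_eq_zero fun i hi => hw i fun hiS => hd ⟨i, hi, hiS⟩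
            have h2 := hle F
            have h3 : 0 ≤ ((k + 1 : ℕ) : ℝ) * (δ / 2) := by positivity
            linarith
    -- After division by `k` the bound is `1 / k + δ / 2`, which is at most `δ` once `k > 2 / δ`.
    obtain ⟨k, hk⟩ := exists_nat_gt (2 / δ)
    have hk0 : (0 : ℝ) < k := lt_trans (by positivity) hk
    obtain ⟨S, w, hS, hw, hw0, hsum, hF⟩ := key k
    refine ⟨S, fun n => w n / k, hS, fun n hn => by simp [hw n hn],
      fun n => div_nonneg (hw0 n) hk0.le, ?_, fun F hFA => ?_⟩
    · rw [← Finset.sum_div, hsum, div_self hk0.ne']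
    · rw [← Finset.sum_div, div_le_iff₀ hk0]
      have := hF F hFA
      rw [div_lt_iff₀ hδ] at hk
      linarith

end Thin

/-! ### Limits of bounded functions along ultrafilters -/

section Ulim

variable {α β : Type*}

/-- The limit of a bounded function along an ultrafilter. -/
noncomputable def ulim (p : Ultrafilter α) (f : α → ℂ) : ℂ := limUnder (p : Filter α) f

theorem tendsto_ulim {f : α → ℂ} (hf : ∃ C : ℝ, ∀ x, ‖f x‖ ≤ C) (p : Ultrafilter α) :
    Tendsto f p (𝓝 (ulim p f)) := by
  obtain ⟨C, hC⟩ := hf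
  have hK : IsCompact (Metric.closedBall (0 : ℂ) C) := isCompact_closedBall _ _
  obtain ⟨a, -, ha⟩ := hK.ultrafilter_le_nhds (p.map f)
    (le_principal_iff.2 (Eventually.of_forall (f := (p : Filter α)) fun x => by simpa using hC x))
  exact tendsto_nhds_limUnder ⟨a, ha⟩

theorem ulim_eq {f : α → ℂ} {p : Ultrafilter α} {a : ℂ} (h : Tendsto f p (𝓝 a)) : ulim p f = a :=
  h.limUnder_eq

theorem ulim_mem {f : α → ℂ} (hf : ∃ C : ℝ, ∀ x, ‖f x‖ ≤ C) {p : Ultrafilter α} {s : Set ℂ}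
    (hs : IsClosed s) (h : ∀ᶠ x in p, f x ∈ s) : ulim p f ∈ s :=
  hs.mem_of_tendsto (tendsto_ulim hf p) h

theorem norm_ulim_le {f : α → ℂ} {C : ℝ} (hf : ∀ x, ‖f x‖ ≤ C) (p : Ultrafilter α) :
    ‖ulim p f‖ ≤ C := by
  have := ulim_mem (s := Metric.closedBall 0 C) ⟨C, hf⟩ (p := p) Metric.isClosed_closedBall
    (Eventually.of_forall fun x => by simpa using hf x)
  simpa using this

theorem eventually_norm_sub_ulim {f : α → ℂ} (hf : ∃ C : ℝ, ∀ x, ‖f x‖ ≤ C) (p : Ultrafilter α)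
    {ε : ℝ} (hε : 0 < ε) : ∀ᶠ x in p, ‖f x - ulim p f‖ < ε := by
  simpa [dist_eq_norm] using Metric.tendsto_nhds.1 (tendsto_ulim hf p) ε hε

theorem ulim_congr {f g : α → ℂ} {p : Ultrafilter α} (hf : ∃ C : ℝ, ∀ x, ‖f x‖ ≤ C)
    (h : ∀ᶠ x in p, g x = f x) : ulim p g = ulim p f :=
  ulim_eq ((tendsto_ulim hf p).congr' (h.mono fun _ hx => hx.symm))

theorem ulim_map (p : Ultrafilter α) (g : α → β) (f : β → ℂ) :
    ulim (p.map g) f = ulim p fun x => f (g x) := rfl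

/-- Limits along an ultrafilter sum of ultrafilters are iterated limits; this turns double limits
into limits along one ultrafilter. -/
theorem ulim_bind (q : Ultrafilter α) (m : α → Ultrafilter β) {f : β → ℂ}
    (hf : ∃ C : ℝ, ∀ x, ‖f x‖ ≤ C) :
    ulim (q.bind m) f = ulim q fun x => ulim (m x) f := by
  refine (ulim_eq (Metric.tendsto_nhds.2 fun ε hε => ?_)).symm
  have h : ∀ᶠ x in q, ∀ᶠ y in m x, ‖f y - ulim (q.bind m) f‖ < ε / 2 :=
    eventually_norm_sub_ulim hf (q.bind m) (half_pos hε)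
  filter_upwards [h] with x hx
  have := ulim_mem (s := Metric.closedBall (ulim (q.bind m) f) (ε / 2)) hf (p := m x)
    Metric.isClosed_closedBall (hx.mono fun y hy => by simpa [dist_eq_norm] using hy.le)
  rw [Metric.mem_closedBall] at this
  linarith

theorem ulim_sub_le {f g : α → ℂ} (hf : ∃ C : ℝ, ∀ x, ‖f x‖ ≤ C) (hg : ∃ C : ℝ, ∀ x, ‖g x‖ ≤ C)
    {p : Ultrafilter α} {ε : ℝ} (h : ∀ᶠ x in p, ‖f x - g x‖ ≤ ε) :
    ‖ulim p f - ulim p g‖ ≤ ε :=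
  le_of_tendsto ((tendsto_ulim hf p).sub (tendsto_ulim hg p)).norm h

theorem continuous_ulim {f : α → ℂ} (hf : ∃ C : ℝ, ∀ x, ‖f x‖ ≤ C) :
    Continuous fun p : Ultrafilter α => ulim p f := by
  rw [continuous_iff_continuousAt]
  intro p
  refine Metric.tendsto_nhds.2 fun ε hε => ?_
  have h := eventually_norm_sub_ulim hf p (half_pos hε)
  have hopen : {r : Ultrafilter α | {x | ‖f x - ulim p f‖ < ε / 2} ∈ r} ∈ 𝓝 p :=
    (ultrafilter_isOpen_basic _).mem_nhds h
  filter_upwards [hopen] with r hr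
  have := ulim_mem (s := Metric.closedBall (ulim p f) (ε / 2)) hf (p := r)
    Metric.isClosed_closedBall
    (Filter.mem_of_superset hr fun y hy => by simpa [dist_eq_norm] using le_of_lt hy)
  rw [Metric.mem_closedBall] at this
  linarith

/-- Finitely many bounded functions take finitely many values, up to `δ`. -/
theorem exists_finset_net {ι : Type*} (I : Finset ι) (F : ι → α → ℂ)
    (hF : ∀ i, ∃ C : ℝ, ∀ x, ‖F i x‖ ≤ C) {δ : ℝ} (hδ : 0 < δ) :
    ∃ D : Finset α, ∀ x, ∃ d ∈ D, ∀ i ∈ I, ‖F i x - F i d‖ < δ := by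
  classical
  rcases isEmpty_or_nonempty α with _ | _
  · exact ⟨∅, fun x => isEmptyElim x⟩
  choose C hC using hF
  let Φ : α → (I → ℂ) := fun x i => F i x
  have hb : range Φ ⊆ Set.pi univ fun i : I => Metric.closedBall (0 : ℂ) (C i) := by
    rintro _ ⟨x, rfl⟩ i -
    simpa using hC i x
  have htb : TotallyBounded (range Φ) :=
    (isCompact_univ_pi fun i : I => isCompact_closedBall (0 : ℂ) (C i)).totallyBounded.subset hb
  obtain ⟨t, ht, htf, hcov⟩ := Metric.finite_approx_of_totallyBounded htb δ hδ
  have h : ∀ y ∈ t, ∃ x, Φ x = y := fun y hy => ht hy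
  choose! c hc using h
  refine ⟨htf.toFinset.image c, fun x => ?_⟩
  obtain ⟨y, hy, hxy⟩ := mem_iUnion₂.1 (hcov ⟨x, rfl⟩)
  refine ⟨c y, Finset.mem_image_of_mem _ (htf.mem_toFinset.2 hy), fun i hi => ?_⟩
  have h1 : dist (Φ x ⟨i, hi⟩) (Φ (c y) ⟨i, hi⟩) < δ := by
    rw [hc y hy]
    exact (dist_le_pi_dist _ _ _).trans_lt hxy
  rwa [dist_eq_norm] at h1

end Ulim

section Ulim

variable {α β : Type*}

theorem ulim_sub {f g : α → ℂ} (hf : ∃ C : ℝ, ∀ x, ‖f x‖ ≤ C) (hg : ∃ C : ℝ, ∀ x, ‖g x‖ ≤ C)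
    (p : Ultrafilter α) : ulim p (fun x => f x - g x) = ulim p f - ulim p g :=
  ulim_eq ((tendsto_ulim hf p).sub (tendsto_ulim hg p))

theorem ulim_add {f g : α → ℂ} (hf : ∃ C : ℝ, ∀ x, ‖f x‖ ≤ C) (hg : ∃ C : ℝ, ∀ x, ‖g x‖ ≤ C)
    (p : Ultrafilter α) : ulim p (fun x => f x + g x) = ulim p f + ulim p g :=
  ulim_eq ((tendsto_ulim hf p).add (tendsto_ulim hg p))

theorem ulim_mul {f g : α → ℂ} (hf : ∃ C : ℝ, ∀ x, ‖f x‖ ≤ C) (hg : ∃ C : ℝ, ∀ x, ‖g x‖ ≤ C)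
    (p : Ultrafilter α) : ulim p (fun x => f x * g x) = ulim p f * ulim p g :=
  ulim_eq ((tendsto_ulim hf p).mul (tendsto_ulim hg p))

theorem ulim_const (p : Ultrafilter α) (c : ℂ) : ulim p (fun _ => c) = c :=
  ulim_eq tendsto_const_nhds

theorem ulim_star {f : α → ℂ} (hf : ∃ C : ℝ, ∀ x, ‖f x‖ ≤ C) (p : Ultrafilter α) :
    ulim p (fun x => star (f x)) = star (ulim p f) :=
  ulim_eq ((continuous_star.tendsto _).comp (tendsto_ulim hf p))

end Ulim

theorem BoundedContinuousFunction.exists_bound {X : Type*} [TopologicalSpace X] (f : X →ᵇ ℂ) :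
    ∃ C : ℝ, ∀ x, ‖f x‖ ≤ C := ⟨‖f‖, f.norm_coe_le_norm⟩

/-- A bounded sequence in `CB(X)` which tends to zero at each ultrafilter on `X` is not bounded away
from zero under a functional. -/
theorem exists_norm_lt_of_tendsto_ulim {X : Type*} [TopologicalSpace X] (F : ℕ → X →ᵇ ℂ) {C : ℝ}
    (hC : ∀ n, ‖F n‖ ≤ C)
    (hF : ∀ p : Ultrafilter X, Tendsto (fun n => ulim p (F n)) atTop (𝓝 0))
    (m : StrongDual ℂ (X →ᵇ ℂ)) {ε : ℝ} (hε : 0 < ε) : ∃ n, ‖m (F n)‖ < ε := by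
  by_contra! hm
  have hC0 : 0 ≤ C := (norm_nonneg _).trans (hC 0)
  set δ : ℝ := ε / (2 * (‖m‖ + 1) * (1 + C)) with hδdef
  have hpos : 0 < 2 * (‖m‖ + 1) * (1 + C) := by positivity
  have hδ : 0 < δ := div_pos hε hpos
  -- If this family were not thin, there would be indices `n k` and points `x j` with `F (n k) (x
  -- j)` of size at least `δ` for `k < j`. A limit ultrafilter of the points `x j` would contradict
  -- the convergence to zero.
  let 𝒜 : Set (Finset ℕ) := {I | ∃ x, ∀ n ∈ I, δ ≤ ‖F n x‖}
  have hA : ∀ I ∈ 𝒜, ∀ I' ⊆ I, I' ∈ 𝒜 := fun I ⟨x, hx⟩ I' hI => ⟨x, fun n hn => hx n (hI hn)⟩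
  have hthin : Thin 𝒜 := by
    by_contra hnot
    obtain ⟨n, hn, hn'⟩ := exists_strictMono_of_not_thin hA hnot
    choose x hx using hn'
    let p : Ultrafilter X := (hyperfilter ℕ).map x
    have h1 : ∀ k, δ ≤ ‖ulim p (F (n k))‖ := by
      intro k
      have h2 : ∀ᶠ y in p, F (n k) y ∈ {z : ℂ | δ ≤ ‖z‖} := by
        change ∀ᶠ j in (hyperfilter ℕ : Filter ℕ), δ ≤ ‖F (n k) (x j)‖
        have h3 : ∀ᶠ j in atTop, k < j := eventually_gt_atTop k
        refine (h3.filter_mono Nat.hyperfilter_le_atTop).mono fun j hj => hx j _ ?_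
        exact Finset.mem_image_of_mem _ (Finset.mem_range.2 hj)
      exact ulim_mem (F (n k)).exists_bound (isClosed_le continuous_const continuous_norm) h2
    have h2 := ((hF p).comp hn.tendsto_atTop).norm
    rw [norm_zero] at h2
    exact absurd (ge_of_tendsto h2 (Eventually.of_forall h1)) (not_le.2 hδ)
  obtain ⟨S, w, -, -, hw0, hsum, hle⟩ := hthin.exists_convex hA hδ 0
  -- Rotating each `F n` by a phase makes its image under `m` positive. The convex means then keep
  -- an image of size at least `ε`, although Pták's lemma makes their norm at most `δ * (1 + C)`.
  have hc : ∀ n, ∃ c : ℂ, ‖c‖ ≤ 1 ∧ c * m (F n) = ‖m (F n)‖ := by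
    intro n
    have h0 : m (F n) ≠ 0 := norm_pos_iff.1 (hε.trans_le (hm n))
    refine ⟨‖m (F n)‖ / m (F n), ?_, div_mul_cancel₀ _ h0⟩
    rw [norm_div, Complex.norm_real, norm_norm, div_self (norm_ne_zero_iff.2 h0)]
  choose c hc1 hc2 using hc
  let Φ : X →ᵇ ℂ := ∑ n ∈ S, ((w n : ℂ) * c n) • F n
  have hΦ : ‖Φ‖ ≤ δ * (1 + C) := by
    refine (BoundedContinuousFunction.norm_le (by positivity)).2 fun x => ?_
    have h1 : ‖Φ x‖ ≤ ∑ n ∈ S, w n * ‖F n x‖ := by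
      simp only [Φ, BoundedContinuousFunction.coe_sum, Finset.sum_apply,
        BoundedContinuousFunction.coe_smul, smul_eq_mul]
      refine (norm_sum_le _ _).trans (Finset.sum_le_sum fun n _ => ?_)
      rw [norm_mul, norm_mul, Complex.norm_real, Real.norm_of_nonneg (hw0 n)]
      exact mul_le_mul_of_nonneg_right (mul_le_of_le_one_right (hw0 n) (hc1 n)) (norm_nonneg _)
    refine h1.trans ?_
    classical
    rw [← Finset.sum_filter_add_sum_filter_not S (fun n => δ ≤ ‖F n x‖)]
    have h2 : ∑ n ∈ S with δ ≤ ‖F n x‖, w n * ‖F n x‖ ≤ δ * C := by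
      have h3 := hle (S.filter fun n => δ ≤ ‖F n x‖) ⟨x, fun n hn => (Finset.mem_filter.1 hn).2⟩
      calc _ ≤ ∑ n ∈ S with δ ≤ ‖F n x‖, w n * C := Finset.sum_le_sum fun n _ =>
              mul_le_mul_of_nonneg_left (((F n).norm_coe_le_norm x).trans (hC n)) (hw0 n)
        _ ≤ δ * C := by
              rw [← Finset.sum_mul]
              exact mul_le_mul_of_nonneg_right h3 hC0
    have h4 : ∑ n ∈ S with ¬ δ ≤ ‖F n x‖, w n * ‖F n x‖ ≤ δ := by
      calc _ ≤ ∑ n ∈ S with ¬ δ ≤ ‖F n x‖, w n * δ := Finset.sum_le_sum fun n hn =>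
              mul_le_mul_of_nonneg_left (not_le.1 (Finset.mem_filter.1 hn).2).le (hw0 n)
        _ ≤ ∑ n ∈ S, w n * δ := Finset.sum_le_sum_of_subset_of_nonneg (Finset.filter_subset _ _)
              fun n _ _ => mul_nonneg (hw0 n) hδ.le
        _ = δ := by rw [← Finset.sum_mul, hsum, one_mul]
    linarith
  have h1 : m Φ = ((∑ n ∈ S, w n * ‖m (F n)‖ : ℝ) : ℂ) := by
    simp only [Φ, map_sum, map_smul, smul_eq_mul, mul_assoc, hc2]
    push_cast
    rfl
  have h2 : ε ≤ ‖m Φ‖ := by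
    rw [h1, Complex.norm_real]
    refine le_trans ?_ (le_abs_self _)
    calc ε = ∑ n ∈ S, w n * ε := by rw [← Finset.sum_mul, hsum, one_mul]
      _ ≤ _ := Finset.sum_le_sum fun n _ => mul_le_mul_of_nonneg_left (hm n) (hw0 n)
  have h3 : ‖m Φ‖ ≤ ‖m‖ * (δ * (1 + C)) :=
    (m.le_opNorm Φ).trans (mul_le_mul_of_nonneg_left hΦ (norm_nonneg _))
  have h4 : 2 * (‖m‖ + 1) * (1 + C) * δ = ε := by
    rw [hδdef, mul_div_cancel₀ _ hpos.ne']
  have h5 : 0 ≤ ‖m‖ * (δ * (1 + C)) := by positivity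
  nlinarith [mul_pos hδ (by linarith : 0 < 1 + C)]

/-! ### Grothendieck's double limit criterion -/

section Criterion

variable {G : Type*} [Group G]

/-- The ultrafilter of the sets `A` with `s * t ∈ A` for `q`-almost all `s`, for `p`-almost all `t`. -/
noncomputable def mulL (q p : Ultrafilter G) : Ultrafilter G := q.bind fun s => p.map (s * ·)

/-- The ultrafilter of the sets `A` with `s * t ∈ A` for `p`-almost all `t`, for `q`-almost all `s`. -/
noncomputable def mulR (q p : Ultrafilter G) : Ultrafilter G := p.bind fun t => q.map (· * t)

theorem mem_mulL {q p : Ultrafilter G} {A : Set G} :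
    A ∈ mulL q p ↔ ∀ᶠ s in q, ∀ᶠ t in p, s * t ∈ A := Iff.rfl

theorem mem_mulR {q p : Ultrafilter G} {A : Set G} :
    A ∈ mulR q p ↔ ∀ᶠ t in p, ∀ᶠ s in q, s * t ∈ A := Iff.rfl

theorem ulim_mulL (q p : Ultrafilter G) {f : G → ℂ} (hf : ∃ C : ℝ, ∀ x, ‖f x‖ ≤ C) :
    ulim (mulL q p) f = ulim q fun s => ulim p fun t => f (s * t) := ulim_bind q _ hf

theorem ulim_mulR (q p : Ultrafilter G) {f : G → ℂ} (hf : ∃ C : ℝ, ∀ x, ‖f x‖ ≤ C) :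
    ulim (mulR q p) f = ulim p fun t => ulim q fun s => f (s * t) := ulim_bind p _ hf

variable [TopologicalSpace G] [IsTopologicalGroup G]

/-- The pointwise limit along `q` of the left translates of a function with the double limit
property. -/
noncomputable def translateLim (f : G →ᵇ ℂ)
    (hf : ∀ q p : Ultrafilter G, ulim (mulL q p) f = ulim (mulR q p) f) (q : Ultrafilter G) :
    G →ᵇ ℂ :=
  BoundedContinuousFunction.ofNormedAddCommGroup (fun t => ulim q fun s => f (s * t))
    (by
      rw [continuous_iff_continuousAt]
      intro t
      rw [continuousAt_iff_ultrafilter]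
      intro p hp
      have hb : ∃ C : ℝ, ∀ t, ‖ulim q fun s => f (s * t)‖ ≤ C :=
        ⟨‖f‖, fun t => norm_ulim_le (fun s => f.norm_coe_le_norm _) q⟩
      -- The double limit property moves the limit `t' → t` along `p` inside the limit along `q`,
      -- where the continuity of `f` applies.
      have h := tendsto_ulim hb p
      rw [← ulim_mulR q p f.exists_bound, ← hf, ulim_mulL q p f.exists_bound] at h
      have h2 : ∀ s, (ulim p fun t => f (s * t)) = f (s * t) := fun s =>
        ulim_eq (((f.continuous.comp (continuous_const_mul s)).tendsto t).mono_left hp)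
      simp only [h2] at h
      exact h)
    ‖f‖ (fun _ => norm_ulim_le (fun _ => f.norm_coe_le_norm _) q)

/-- Pták's argument needs a sequence, whereas `q` is only an ultrafilter. The sequence `s n` is
built together with finite sets `D n`: each point `y` is approximated by some `d n` in `D n` for the
functions chosen so far, and later functions are small on `D n`. Exchanging the limits over `i` and
`n` of `F (s i) (d n)` shows that `F (s n) y` tends to `0`. A second exchange gives the same at
every ultrafilter `p`. -/
theorem exists_seq_tendsto_ulim (f : G →ᵇ ℂ)
    (hf : ∀ q p : Ultrafilter G, ulim (mulL q p) f = ulim (mulR q p) f) (q : Ultrafilter G)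
    {S : Set G} (hS : S ∈ q) :
    ∃ s : ℕ → G, (∀ n, s n ∈ S) ∧ ∀ p : Ultrafilter G,
      Tendsto (fun n => ulim p (leftTranslate (s n) f - translateLim f hf q : G →ᵇ ℂ)) atTop
        (𝓝 0) := by
  classical
  set F : G → G →ᵇ ℂ := fun s => leftTranslate s f - translateLim f hf q with hFdef
  have hF0 : ∀ d, ∀ ε : ℝ, 0 < ε → ∀ᶠ s in q, ‖F s d‖ < ε := fun d ε hε =>
    eventually_norm_sub_ulim ⟨‖f‖, fun s => f.norm_coe_le_norm _⟩ q hε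
  -- The components of a term are the earlier translating elements, the new one, its finite net, and
  -- an integer controlling the precision.
  obtain ⟨x, hxP, hxr⟩ := exists_seq_of_forall_finset_exists
    (α := Finset G × G × Finset G × ℕ)
    (fun x => x.2.1 ∈ S ∧ ∀ y, ∃ d ∈ x.2.2.1, ∀ i ∈ insert x.2.1 x.1,
      ‖F i y - F i d‖ < 1 / ((x.2.2.2 : ℝ) + 1))
    (fun x y => x.2.2.2 < y.2.2.2 ∧ x.2.1 ∈ y.1 ∧
      ∀ d ∈ x.2.2.1, ‖F y.2.1 d‖ < 1 / ((y.2.2.2 : ℝ) + 1)) (by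
      intro 𝒮 _
      let k : ℕ := 𝒮.sup (fun x => x.2.2.2) + 1
      have hk : (0 : ℝ) < 1 / ((k : ℝ) + 1) := by positivity
      have h1 : ∀ᶠ s in q, ∀ d ∈ 𝒮.biUnion (fun x => x.2.2.1), ‖F s d‖ < 1 / ((k : ℝ) + 1) :=
        (Finset.eventually_all _).2 fun d _ => hF0 d _ hk
      obtain ⟨s, hs, hsS⟩ := (h1.and hS).exists
      obtain ⟨D, hD⟩ := exists_finset_net (insert s (𝒮.image fun x => x.2.1))
        (fun i => ⇑(F i)) (fun i => (F i).exists_bound) hk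
      refine ⟨(𝒮.image fun x => x.2.1, s, D, k), ⟨hsS, hD⟩, fun x hx => ⟨?_, ?_, ?_⟩⟩
      · exact Nat.lt_succ_of_le (Finset.le_sup (f := fun x : Finset G × G × Finset G × ℕ => x.2.2.2) hx)
      · exact Finset.mem_image_of_mem _ hx
      · exact fun d hd => hs d (Finset.mem_biUnion.2 ⟨x, hx, hd⟩))
  have hk : StrictMono fun n => (x n).2.2.2 := fun m n hmn => (hxr m n hmn).1
  have hlim : Tendsto (fun n => 1 / (((x n).2.2.2 : ℝ) + 1)) atTop (𝓝 0) :=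
    tendsto_one_div_add_atTop_nhds_zero_nat.comp hk.tendsto_atTop
  refine ⟨fun n => (x n).2.1, fun n => (hxP n).1, fun p => ?_⟩
  rw [tendsto_iff_ultrafilter]
  intro 𝒰 hU
  have hCF : ∀ s y, ‖F s y‖ ≤ ‖f‖ + ‖f‖ := fun s y =>
    (norm_sub_le _ _).trans (add_le_add (f.norm_coe_le_norm _)
      (norm_ulim_le (fun _ => f.norm_coe_le_norm _) q))
  have hb1 : ∀ r : Ultrafilter G, ∃ C : ℝ, ∀ n, ‖ulim r (F (x n).2.1)‖ ≤ C := fun r =>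
    ⟨_, fun n => norm_ulim_le (hCF _) r⟩
  -- The double limit property of `f` is inherited by `F`, with the sequence as one of the two
  -- ultrafilters.
  have hswap : ∀ r : Ultrafilter G, (ulim 𝒰 fun n => ulim r (F (x n).2.1)) =
      ulim r fun y => ulim 𝒰 fun n => F (x n).2.1 y := by
    intro r
    have h1 : ∀ s, ulim r (F s) = (ulim r fun t => f (s * t)) - ulim r (translateLim f hf q) :=
      fun s => ulim_sub ⟨‖f‖, fun t => f.norm_coe_le_norm _⟩
        (translateLim f hf q).exists_bound r
    have h2 : ∀ y, (ulim 𝒰 fun n => F (x n).2.1 y) =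
        (ulim 𝒰 fun n => f ((x n).2.1 * y)) - translateLim f hf q y := by
      intro y
      rw [← ulim_const 𝒰 (translateLim f hf q y)]
      exact ulim_sub ⟨‖f‖, fun n => f.norm_coe_le_norm _⟩ ⟨‖translateLim f hf q y‖, fun _ => le_rfl⟩ _
    simp only [h1, h2]
    rw [ulim_sub ⟨‖f‖, fun n => norm_ulim_le (fun _ => f.norm_coe_le_norm _) _⟩
        ⟨‖ulim r (translateLim f hf q)‖, fun _ => le_rfl⟩,
      ulim_sub ⟨‖f‖, fun n => norm_ulim_le (fun _ => f.norm_coe_le_norm _) _⟩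
        (translateLim f hf q).exists_bound, ulim_const]
    congr 1
    have h3 := hf (𝒰.map fun n => (x n).2.1) r
    rw [ulim_mulL _ _ f.exists_bound, ulim_mulR _ _ f.exists_bound] at h3
    exact h3
  have hzero : ∀ y, (ulim 𝒰 fun n => F (x n).2.1 y) = 0 := by
    intro y
    choose d hdD hd using fun n => (hxP n).2 y
    have h1 : ∀ i, ulim (𝒰.map d) (F (x i).2.1) = F (x i).2.1 y := by
      intro i
      refine ulim_eq (f := F (x i).2.1) ?_
      change Tendsto (F (x i).2.1) (map d 𝒰) _
      rw [tendsto_map'_iff, tendsto_iff_norm_sub_tendsto_zero]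
      refine Tendsto.mono_left ?_ hU
      refine squeeze_zero' (Eventually.of_forall fun _ => norm_nonneg _) ?_ hlim
      filter_upwards [eventually_ge_atTop i] with n hn
      rw [norm_sub_rev]
      refine (hd n _ ?_).le
      rcases hn.eq_or_lt with rfl | hn
      · exact Finset.mem_insert_self _ _
      · exact Finset.mem_insert_of_mem (hxr i n hn).2.1
    have h2 : ∀ n, (ulim 𝒰 fun i => F (x i).2.1 (d n)) = 0 := by
      intro n
      refine ulim_eq (tendsto_zero_iff_norm_tendsto_zero.2 (Tendsto.mono_left ?_ hU))
      refine squeeze_zero' (Eventually.of_forall fun _ => norm_nonneg _) ?_ hlim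
      filter_upwards [eventually_gt_atTop n] with i hi
      exact ((hxr n i hi).2.2 _ (hdD n)).le
    have h3 := hswap (𝒰.map d)
    simp only [h1, ulim_map, h2, ulim_const] at h3
    exact h3
  have h := tendsto_ulim (hb1 p) 𝒰
  rw [hswap p] at h
  simp only [hzero, ulim_const] at h
  exact h

/-- If weak convergence failed, the elements violating it for `m` would form a set in `q`. A
sequence in this set would converge to zero at every point of `βG` while `m` stayed bounded away
from zero on it, against `exists_norm_lt_of_tendsto_ulim`. -/
theorem tendsto_leftTranslate (f : G →ᵇ ℂ)
    (hf : ∀ q p : Ultrafilter G, ulim (mulL q p) f = ulim (mulR q p) f) (q : Ultrafilter G)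
    (m : StrongDual ℂ (G →ᵇ ℂ)) :
    Tendsto (fun s => m (leftTranslate s f)) q (𝓝 (m (translateLim f hf q))) := by
  rw [Metric.tendsto_nhds]
  intro ε hε
  by_contra hcon
  have hS : {s : G | ε ≤ dist (m (leftTranslate s f)) (m (translateLim f hf q))} ∈ q := by
    have := Ultrafilter.eventually_not.2 hcon
    exact this.mono fun s hs => not_lt.1 hs
  obtain ⟨s, hs, hlim⟩ := exists_seq_tendsto_ulim f hf q hS
  obtain ⟨n, hn⟩ := exists_norm_lt_of_tendsto_ulim
    (fun n => leftTranslate (s n) f - translateLim f hf q) (C := ‖f‖ + ‖f‖) (fun n => by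
      refine (norm_sub_le _ _).trans (add_le_add ?_ ?_)
      · exact (BoundedContinuousFunction.norm_le (norm_nonneg f)).2 fun t => f.norm_coe_le_norm _
      · exact (BoundedContinuousFunction.norm_le (norm_nonneg f)).2 fun t =>
          norm_ulim_le (fun _ => f.norm_coe_le_norm _) q) hlim m hε
  have := hs n
  rw [mem_ofPred_eq, dist_eq_norm, ← map_sub] at this
  exact absurd hn (not_lt.2 this)

/-- **Grothendieck's criterion**, with ultrafilters: a bounded continuous function is weakly almost
periodic if and only if its iterated limits agree. -/
theorem mem_WAP_iff {f : G →ᵇ ℂ} :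
    f ∈ WAP G ↔ ∀ q p : Ultrafilter G, ulim (mulL q p) f = ulim (mulR q p) f := by
  constructor
  · intro hf q p
    obtain ⟨g, -, hg⟩ := IsCompact.ultrafilter_le_nhds hf
      (q.map fun s : G => toWeakSpace ℂ (G →ᵇ ℂ) (leftTranslate s f))
      (le_principal_iff.2 (Eventually.of_forall (f := (q : Filter G)) fun s =>
        subset_closure ⟨s, rfl⟩))
    have hm : ∀ m : StrongDual ℂ (G →ᵇ ℂ),
        Tendsto (fun s => m (leftTranslate s f)) q (𝓝 (m ((toWeakSpace ℂ (G →ᵇ ℂ)).symm g))) :=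
      fun m => ((WeakBilin.eval_continuous (topDualPairing ℂ (G →ᵇ ℂ)).flip m).tendsto g).comp hg
    rw [ulim_mulL q p f.exists_bound, ulim_mulR q p f.exists_bound]
    have h1 : ∀ t, (ulim q fun s => f (s * t)) = (toWeakSpace ℂ (G →ᵇ ℂ)).symm g t := fun t =>
      ulim_eq (hm (BoundedContinuousFunction.evalCLM ℂ t))
    simp only [h1]
    -- The limit along `p` is itself a bounded functional, so weak convergence of the translates
    -- along `q` passes through it and exchanges the limits.
    let m : StrongDual ℂ (G →ᵇ ℂ) := LinearMap.mkContinuous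
      { toFun := fun h => ulim p h
        map_add' := fun h k => ulim_add h.exists_bound k.exists_bound p
        map_smul' := fun c h => ulim_eq ((tendsto_ulim h.exists_bound p).const_mul c) } 1
      (fun h => by
        rw [one_mul]
        exact norm_ulim_le h.norm_coe_le_norm p)
    exact ulim_eq (hm m)
  · intro hf
    -- The orbit lies in the image of the compact space `βG` under a weakly continuous map;
    -- principal ultrafilters give the translates themselves.
    have hΦ : Continuous fun q : Ultrafilter G => toWeakSpace ℂ (G →ᵇ ℂ) (translateLim f hf q) := by
      refine WeakBilin.continuous_of_continuous_eval _ fun m => ?_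
      have hb : ∃ C : ℝ, ∀ s, ‖(m : StrongDual ℂ (G →ᵇ ℂ)) (leftTranslate s f)‖ ≤ C := by
        refine ⟨‖(m : StrongDual ℂ (G →ᵇ ℂ))‖ * ‖f‖, fun s =>
          ((m : StrongDual ℂ (G →ᵇ ℂ)).le_opNorm _).trans
            (mul_le_mul_of_nonneg_left ?_ (norm_nonneg _))⟩
        exact (BoundedContinuousFunction.norm_le (norm_nonneg f)).2 fun t => f.norm_coe_le_norm _
      refine (continuous_ulim hb).congr fun q => ?_
      exact ulim_eq (tendsto_leftTranslate f hf q m)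
    refine IsWAP.of_subset (isCompact_range hΦ) ?_
    rintro _ ⟨s, rfl⟩
    refine ⟨pure s, congrArg (toWeakSpace ℂ (G →ᵇ ℂ)) ?_⟩
    ext t
    exact ulim_eq (tendsto_pure_nhds _ _)

end Criterion

/-! ### Algebraic operations on `WAP(G)`, and uniform continuity of its members -/

section Algebra

variable {G : Type*} [TopologicalSpace G] [Group G] [IsTopologicalGroup G]

/-- Limits along ultrafilters are multiplicative, so the double limit criterion is stable under
products. -/
theorem mul_mem_WAP {f g : G →ᵇ ℂ} (hf : f ∈ WAP G) (hg : g ∈ WAP G) : f * g ∈ WAP G := by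
  rw [mem_WAP_iff] at *
  intro q p
  simp only [BoundedContinuousFunction.coe_mul]
  have h := fun r : Ultrafilter G => ulim_mul f.exists_bound g.exists_bound r
  exact (h _).trans ((congrArg₂ (· * ·) (hf q p) (hg q p)).trans (h _).symm)

theorem star_mem_WAP {f : G →ᵇ ℂ} (hf : f ∈ WAP G) : star f ∈ WAP G := by
  rw [mem_WAP_iff] at *
  intro q p
  have h := fun r : Ultrafilter G => ulim_star f.exists_bound r
  exact (h _).trans ((congrArg star (hf q p)).trans (h _).symm)

theorem continuous_ulim_mul {f : G →ᵇ ℂ} (hf : f ∈ WAP G) (p : Ultrafilter G) :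
    Continuous fun g : G => ulim p fun t => f (g * t) := by
  rw [continuous_iff_continuousAt]
  intro g
  rw [continuousAt_iff_ultrafilter]
  intro q hq
  have h := tendsto_ulim (f := fun g : G => ulim p fun t => f (g * t))
    ⟨‖f‖, fun g => norm_ulim_le (fun _ => f.norm_coe_le_norm _) p⟩ q
  rw [← ulim_mulL q p f.exists_bound, mem_WAP_iff.1 hf, ulim_mulR q p f.exists_bound] at h
  have h2 : ∀ t, (ulim q fun s => f (s * t)) = f (g * t) := fun t =>
    ulim_eq (((f.continuous.comp (continuous_mul_const t)).tendsto g).mono_left hq)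
  simp only [h2] at h
  exact h

/-- Translation of a weakly almost periodic function is norm continuous on separable closed
subgroups. -/
theorem exists_nhds_norm_sub_le_of_separable [T2Space G] [LocallyCompactSpace G] {f : G →ᵇ ℂ}
    (hf : f ∈ WAP G) (H : Subgroup G) (hH : IsClosed (H : Set G)) (D : ℕ → G)
    (hD : (H : Set G) ⊆ closure (range D)) {ε : ℝ} (hε : 0 < ε) :
    ∃ N ∈ 𝓝 (1 : G), ∀ u ∈ N, u ∈ H → ∀ t, ‖f (u * t) - f t‖ ≤ ε := by
  set η := ε / 3 with hηdef
  have hη : 0 < η := by positivity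
  -- `E n` collects the `g` at which agreement of `t` and `t'` on the first `n` points of `D`, up to
  -- `1 / (n + 1)`, forces agreement up to `η`. If some `g` were in no `E n`, two ultrafilter limits
  -- of translates would agree on the dense set `D` but differ at `g`, although both are continuous.
  let E : ℕ → Set H := fun n => {g | ∀ t t' : G,
    (∀ i ∈ Finset.range n, ‖f (D i * t) - f (D i * t')‖ < 1 / ((n : ℝ) + 1)) →
      ‖f (g * t) - f (g * t')‖ ≤ η}
  have hEc : ∀ n, IsClosed (E n) := by
    intro n
    simp only [E, ofPred_forall]
    refine isClosed_iInter fun t => isClosed_iInter fun t' => isClosed_iInter fun _ => ?_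
    refine isClosed_le (Continuous.norm (Continuous.sub ?_ ?_)) continuous_const
    · exact f.continuous.comp ((continuous_mul_const t).comp continuous_subtype_val)
    · exact f.continuous.comp ((continuous_mul_const t').comp continuous_subtype_val)
  have hEu : ⋃ n, E n = univ := by
    refine eq_univ_of_forall fun g => mem_iUnion.2 ?_
    by_contra! hcon
    simp only [E, mem_ofPred_eq, not_forall, not_le] at hcon
    choose t t' htt hgt using hcon
    let 𝒰 := hyperfilter ℕ
    have hb : ∀ (s : ℕ → G) (d : G), ∃ C : ℝ, ∀ n, ‖f (d * s n)‖ ≤ C := fun s d =>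
      ⟨‖f‖, fun n => f.norm_coe_le_norm _⟩
    have heq : EqOn (fun d : G => ulim (𝒰.map t) fun s => f (d * s))
        (fun d : G => ulim (𝒰.map t') fun s => f (d * s)) (range D) := by
      rintro _ ⟨i, rfl⟩
      simp only [ulim_map]
      rw [← sub_eq_zero, ← ulim_sub (hb t _) (hb t' _)]
      refine ulim_eq (tendsto_zero_iff_norm_tendsto_zero.2
        (Tendsto.mono_left ?_ Nat.hyperfilter_le_atTop))
      refine squeeze_zero' (Eventually.of_forall fun _ => norm_nonneg _) ?_
        tendsto_one_div_add_atTop_nhds_zero_nat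
      filter_upwards [eventually_gt_atTop i] with n hn
      exact (htt n i (Finset.mem_range.2 hn)).le
    have h0 := heq.closure (continuous_ulim_mul hf _) (continuous_ulim_mul hf _) (hD g.2)
    simp only [ulim_map] at h0
    rw [← sub_eq_zero, ← ulim_sub (hb t _) (hb t' _)] at h0
    have h1 := ulim_mem (f := fun n => f ((g : G) * t n) - f (g * t' n)) (p := 𝒰)
      ⟨‖f‖ + ‖f‖, fun n => (norm_sub_le _ _).trans
        (add_le_add (f.norm_coe_le_norm _) (f.norm_coe_le_norm _))⟩
      (isClosed_le continuous_const continuous_norm : IsClosed {z : ℂ | η ≤ ‖z‖})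
      (Eventually.of_forall fun n => (hgt n).le)
    rw [mem_ofPred_eq, h0, norm_zero] at h1
    exact absurd h1 (not_le.2 hη)
  have : LocallyCompactSpace H := hH.isClosedEmbedding_subtypeVal.locallyCompactSpace
  -- By Baire's theorem some `E n` is a neighbourhood of a point `g₀`. A finite net of points `t`
  -- then reduces uniform estimates near `g₀` to finitely many continuous functions.
  obtain ⟨n, g₀, hg₀⟩ := nonempty_interior_of_iUnion_of_closed hEc hEu
  obtain ⟨Dt, hDt⟩ := exists_finset_net (Finset.range n) (fun i t => f (D i * t))
    (fun i => ⟨‖f‖, fun n => f.norm_coe_le_norm _⟩) (δ := 1 / ((n : ℝ) + 1)) (by positivity)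
  have hev : ∀ᶠ g : H in 𝓝 g₀, g ∈ E n ∧ ∀ d ∈ Dt, ‖f (g * d) - f (g₀ * d)‖ < η := by
    refine Eventually.and (mem_interior_iff_mem_nhds.1 hg₀) ((Finset.eventually_all Dt).2 fun d _ => ?_)
    have hc : Continuous fun g : H => f (g * d) :=
      f.continuous.comp ((continuous_mul_const d).comp continuous_subtype_val)
    simpa [dist_eq_norm] using Metric.tendsto_nhds.1 (hc.tendsto g₀) η hη
  have hev2 : ∀ᶠ u : H in 𝓝 1, u * g₀ ∈ E n ∧
      ∀ d ∈ Dt, ‖f (u * g₀ * d) - f (g₀ * d)‖ < η := by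
    have : Tendsto (fun u : H => u * g₀) (𝓝 1) (𝓝 g₀) := by
      simpa using (continuous_mul_const g₀).tendsto (1 : H)
    exact this.eventually hev
  rw [nhds_subtype_eq_comap, OneMemClass.coe_one] at hev2
  obtain ⟨N, hN, hN2⟩ := hev2
  refine ⟨N, hN, fun u hu huH t => ?_⟩
  obtain ⟨h1, h2⟩ := @hN2 ⟨u, huH⟩ hu
  -- The values of `f` at `u * t` and `t` are compared through `u * g₀ * d` and `g₀ * d`, with an
  -- error `ε / 3` in each of the three steps.
  obtain ⟨d, hd, hdt⟩ := hDt ((g₀ : G)⁻¹ * t)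
  have e1 := h1 ((g₀ : G)⁻¹ * t) d hdt
  have e2 := interior_subset hg₀ ((g₀ : G)⁻¹ * t) d hdt
  have e3 := (h2 d hd).le
  simp only [Subgroup.coe_mul, mul_assoc, mul_inv_cancel_left] at e1 e2 e3
  have e4 : f (u * t) - f t = (f (u * t) - f (u * (g₀ * d))) +
      (f (u * (g₀ * d)) - f (g₀ * d)) - (f t - f (g₀ * d)) := by ring
  rw [e4]
  refine (norm_sub_le _ _).trans ((add_le_add_left (norm_add_le _ _) _).trans ?_)
  linarith

/-- Weakly almost periodic functions are right uniformly continuous. -/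
theorem exists_nhds_norm_sub_lt [T2Space G] [LocallyCompactSpace G] {f : G →ᵇ ℂ}
    (hf : f ∈ WAP G) {ε : ℝ} (hε : 0 < ε) :
    ∃ N ∈ 𝓝 (1 : G), ∀ u ∈ N, ∀ t, ‖f (u * t) - f t‖ < ε := by
  by_contra! hcon
  obtain ⟨K, hK, hK1⟩ := exists_compact_mem_nhds (1 : G)
  -- Bad pairs `(g, t)` are chosen so that each new `g` hardly moves `f` at the earlier points `t`.
  -- A cluster point `c` of the elements `g` then hardly moves `f` at any chosen `t`. Some `g` is
  -- close to `c` inside a separable closed subgroup, which contradicts the badness of its pair.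
  obtain ⟨x, hxP, hxr⟩ := exists_seq_of_forall_finset_exists (α := G × G)
    (fun x => x.1 ∈ K ∧ ε ≤ ‖f (x.1 * x.2) - f x.2‖)
    (fun x y => ‖f (y.1 * x.2) - f x.2‖ < ε / 4) (by
      intro 𝒮 _
      have h : ∀ᶠ g in 𝓝 (1 : G), g ∈ K ∧ ∀ x ∈ 𝒮, ‖f (g * x.2) - f x.2‖ < ε / 4 := by
        refine Eventually.and hK1 ((Finset.eventually_all 𝒮).2 fun x _ => ?_)
        have hc : Tendsto (fun g : G => f (g * x.2)) (𝓝 1) (𝓝 (f x.2)) := by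
          simpa [Function.comp_def] using (f.continuous.comp (continuous_mul_const x.2)).tendsto 1
        simpa [dist_eq_norm] using Metric.tendsto_nhds.1 hc (ε / 4) (by positivity)
      obtain ⟨g, hg, t, hgt⟩ := hcon _ h
      exact ⟨(g, t), ⟨hg.1, hgt⟩, hg.2⟩)
  -- A countable free group enumerates the subgroup generated by the sequence, hence a dense subset
  -- of its closure.
  obtain ⟨e, he⟩ := exists_surjective_nat (FreeGroup ℕ)
  let H₀ : Subgroup G := Subgroup.closure (range fun n => (x n).1)
  let D : ℕ → G := fun n => FreeGroup.lift (fun n => (x n).1) (e n)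
  have hD : range D = (H₀ : Set G) := by
    have h1 : range D = range (FreeGroup.lift fun n => (x n).1) := he.range_comp _
    rw [h1, ← MonoidHom.coe_range, FreeGroup.range_lift_eq_closure]
  have hxH : ∀ n, (x n).1 ∈ H₀ := fun n => Subgroup.subset_closure ⟨n, rfl⟩
  obtain ⟨N, hN, hN2⟩ := exists_nhds_norm_sub_le_of_separable hf H₀.topologicalClosure
    H₀.isClosed_topologicalClosure D (by rw [hD, Subgroup.topologicalClosure_coe])
    (ε := ε / 4) (by positivity)
  obtain ⟨c, -, hc⟩ := hK.ultrafilter_le_nhds ((hyperfilter ℕ).map fun n => (x n).1)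
    (le_principal_iff.2 (Eventually.of_forall (f := (hyperfilter ℕ : Filter ℕ))
      fun n => (hxP n).1))
  have hc' : Tendsto (fun n => (x n).1) (hyperfilter ℕ) (𝓝 c) := hc
  have hcH : c ∈ H₀.topologicalClosure := mem_closure_of_tendsto hc'
    (Eventually.of_forall fun n => hxH n)
  have h1 : ∀ k, ‖f (c * (x k).2) - f (x k).2‖ ≤ ε / 4 := by
    intro k
    have ht : Tendsto (fun n => ‖f ((x n).1 * (x k).2) - f (x k).2‖) (hyperfilter ℕ)
        (𝓝 ‖f (c * (x k).2) - f (x k).2‖) :=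
      ((((f.continuous.comp (continuous_mul_const (x k).2)).tendsto c).comp hc').sub_const _).norm
    refine le_of_tendsto ht ?_
    exact ((eventually_gt_atTop k).filter_mono Nat.hyperfilter_le_atTop).mono
      fun n hn => (hxr k n hn).le
  have h2 : ∀ᶠ n in (hyperfilter ℕ : Filter ℕ), (x n).1 * c⁻¹ ∈ N := by
    have ht : Tendsto (fun n => (x n).1 * c⁻¹) (hyperfilter ℕ) (𝓝 1) := by
      simpa using hc'.mul_const c⁻¹
    exact ht hN
  obtain ⟨n, hn⟩ := h2.exists
  have h3 := hN2 _ hn (mul_mem (H₀.le_topologicalClosure (hxH n)) (inv_mem hcH)) (c * (x n).2)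
  rw [← mul_assoc, inv_mul_cancel_right] at h3
  have h4 := (hxP n).2
  have h5 := h1 n
  have h6 := norm_add_le (f ((x n).1 * (x n).2) - f (c * (x n).2)) (f (c * (x n).2) - f (x n).2)
  rw [sub_add_sub_cancel] at h6
  linarith

end Algebra

/-! ### Ultrafilters and points of the compactification -/

section Compactification

variable {G : Type*} [TopologicalSpace G] [Group G] [IsTopologicalGroup G]

namespace GWAP

theorem ext_extend {x y : GWAP G} (h : ∀ f : WAP G, extend f x = extend f y) : x = y :=
  Subtype.ext (DFunLike.ext _ _ h)

theorem continuous_extend (f : WAP G) : Continuous (extend f : GWAP G → ℂ) :=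
  (WeakDual.eval_continuous f).comp continuous_subtype_val

theorem continuous_of_extend {X : Type*} [TopologicalSpace X] {φ : X → GWAP G}
    (h : ∀ f : WAP G, Continuous fun x => extend f (φ x)) : Continuous φ :=
  (WeakDual.continuous_of_continuous_eval h).subtype_mk _

instance : T2Space (GWAP G) := inferInstanceAs (T2Space (Subtype _))

/-- The point of `G^WAP` given by the limits along an ultrafilter. -/
noncomputable def ofUltrafilter (p : Ultrafilter G) : GWAP G :=
  ⟨StrongDual.toWeakDual (LinearMap.mkContinuous
      { toFun := fun f : WAP G => ulim p (f : G →ᵇ ℂ)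
        map_add' := fun f g =>
          ulim_add (f : G →ᵇ ℂ).exists_bound (g : G →ᵇ ℂ).exists_bound p
        map_smul' := fun c f =>
          ulim_eq ((tendsto_ulim (f : G →ᵇ ℂ).exists_bound p).const_mul c) } 1
      (fun f => by
        rw [one_mul]
        exact norm_ulim_le (f : G →ᵇ ℂ).norm_coe_le_norm p)), by
    constructor
    · intro h
      have h1 := DFunLike.congr_fun h (⟨1, one_mem_WAP⟩ : WAP G)
      have h2 : ulim p (fun _ : G => (1 : ℂ)) = 0 := h1
      rw [ulim_const] at h2
      exact one_ne_zero h2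
    · intro f₁ f₂ f₃ h
      have h1 := ulim_mul (f₁ : G →ᵇ ℂ).exists_bound (f₂ : G →ᵇ ℂ).exists_bound p
      have h2 : ((f₃ : G →ᵇ ℂ) : G → ℂ) = fun x => (f₁ : G →ᵇ ℂ) x * (f₂ : G →ᵇ ℂ) x :=
        funext fun x => DFunLike.congr_fun h x
      change ulim p ((f₃ : G →ᵇ ℂ) : G → ℂ) = _
      rw [h2]
      exact h1⟩

theorem extend_ofUltrafilter (f : WAP G) (p : Ultrafilter G) :
    extend f (ofUltrafilter p) = ulim p (f : G →ᵇ ℂ) := rfl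

theorem extend_eval (f : WAP G) (g : G) : extend f (eval g) = (f : G →ᵇ ℂ) g := rfl

theorem ofUltrafilter_eq_eval {p : Ultrafilter G} {g : G} (h : (p : Filter G) ≤ 𝓝 g) :
    ofUltrafilter p = eval g :=
  ext_extend fun f => ulim_eq (((f : G →ᵇ ℂ).continuous.tendsto g).mono_left h)

theorem continuous_ofUltrafilter : Continuous (ofUltrafilter : Ultrafilter G → GWAP G) :=
  continuous_of_extend fun f => continuous_ulim (f : G →ᵇ ℂ).exists_bound

theorem ofUltrafilter_mul (q p : Ultrafilter G) :
    ofUltrafilter q * ofUltrafilter p = ofUltrafilter (mulL q p) :=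
  ext_extend fun f => (ulim_mulL q p (f : G →ᵇ ℂ).exists_bound).symm

/-- The two iterated limits give one point of `G^WAP`, so `mulR` may be replaced by `mulL` there. -/
theorem ofUltrafilter_mulR (q p : Ultrafilter G) :
    (ofUltrafilter (mulR q p) : GWAP G) = ofUltrafilter (mulL q p) :=
  ext_extend fun f => (mem_WAP_iff.1 f.2 q p).symm

theorem eval_mul_ofUltrafilter (v : G) (p : Ultrafilter G) :
    eval v * ofUltrafilter p = ofUltrafilter (p.map (v * ·)) :=
  ext_extend fun _ => rfl

theorem extend_eval_mul_ofUltrafilter (f : WAP G) (v : G) (p : Ultrafilter G) :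
    extend f (eval v * ofUltrafilter p) = ulim p fun t => (f : G →ᵇ ℂ) (v * t) := rfl

/-- If `x k = 0`, then `F = 1 - k / M` has norm below `1` for a large constant `M`, while `x (F ^ n)
= 1` for all `n`. This contradicts the boundedness of `x`. -/
theorem extend_ne_zero {x : GWAP G} {k : WAP G} {r : G → ℝ}
    (hk : ∀ s, (k : G →ᵇ ℂ) s = r s) {δ : ℝ} (hδ : 0 < δ) (hr : ∀ s, δ ≤ r s) :
    extend k x ≠ 0 := by
  intro h0
  set M : ℝ := ‖k‖ + δ with hM
  have hM0 : 0 < M := by positivity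
  set ρ : ℝ := 1 - δ / M with hρ
  have hρ1 : ρ < 1 := by
    have : 0 < δ / M := by positivity
    linarith
  have hρ0 : 0 ≤ ρ := by
    have : δ / M ≤ 1 := (div_le_one hM0).2 (by rw [hM]; linarith [norm_nonneg k])
    linarith
  let F : WAP G := ⟨1, one_mem_WAP⟩ - ((M : ℂ)⁻¹) • k
  have hF : ∀ s, ‖(F : G →ᵇ ℂ) s‖ ≤ ρ := by
    intro s
    have h1 : (F : G →ᵇ ℂ) s = ((1 - r s / M : ℝ) : ℂ) := by
      have : (F : G →ᵇ ℂ) s = 1 - (M : ℂ)⁻¹ * (k : G →ᵇ ℂ) s := rfl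
      rw [this, hk]
      push_cast
      ring
    have h2 : r s ≤ M := by
      have h3 : ‖(k : G →ᵇ ℂ) s‖ ≤ ‖k‖ := (k : G →ᵇ ℂ).norm_coe_le_norm s
      rw [hk, Complex.norm_real] at h3
      linarith [le_abs_self (r s), Real.norm_eq_abs (r s)]
    have h3 : r s / M ≤ 1 := (div_le_one hM0).2 h2
    have h4 : δ / M ≤ r s / M := div_le_div_of_nonneg_right (hr s) hM0.le
    rw [h1, Complex.norm_real, Real.norm_of_nonneg (by linarith)]
    linarith
  have hxF : extend F x = 1 := by
    have : extend F x = extend ⟨1, one_mem_WAP⟩ x - (M : ℂ)⁻¹ * extend k x := by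
      simp only [extend, F, map_sub, map_smul, smul_eq_mul]
    rw [this, h0, mul_zero, sub_zero]
    exact map_one x
  have hpow : ∀ n : ℕ, ∃ P : WAP G, ‖P‖ ≤ ρ ^ n ∧ extend P x = 1 := by
    intro n
    induction n with
    | zero =>
      refine ⟨⟨1, one_mem_WAP⟩, ?_, map_one x⟩
      exact (BoundedContinuousFunction.norm_le (by simp)).2 fun s => by simp
    | succ n ih =>
      obtain ⟨P, hP, hPx⟩ := ih
      refine ⟨⟨F * P, mul_mem_WAP F.2 P.2⟩, ?_, ?_⟩
      · refine (BoundedContinuousFunction.norm_le (by positivity)).2 fun s => ?_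
        have h1 : ‖(P : G →ᵇ ℂ) s‖ ≤ ρ ^ n := ((P : G →ᵇ ℂ).norm_coe_le_norm s).trans hP
        change ‖(F : G →ᵇ ℂ) s * (P : G →ᵇ ℂ) s‖ ≤ _
        rw [pow_succ', norm_mul]
        exact mul_le_mul (hF s) h1 (norm_nonneg _) hρ0
      · have h1 := x.2.2 F P ⟨F * P, mul_mem_WAP F.2 P.2⟩ rfl
        have h2 : extend (⟨F * P, mul_mem_WAP F.2 P.2⟩ : WAP G) x = extend F x * extend P x := h1
        rw [h2, hxF, hPx, one_mul]
  have h1 : ∀ n : ℕ, 1 ≤ ‖WeakDual.toStrongDual x.1‖ * ρ ^ n := by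
    intro n
    obtain ⟨P, hP, hPx⟩ := hpow n
    have h2 : ‖extend P x‖ ≤ ‖WeakDual.toStrongDual x.1‖ * ‖P‖ :=
      (WeakDual.toStrongDual x.1).le_opNorm P
    rw [hPx, norm_one] at h2
    exact h2.trans (mul_le_mul_of_nonneg_left hP (ContinuousLinearMap.opNorm_nonneg _))
  have h2 := (tendsto_pow_atTop_nhds_zero_of_lt_one hρ0 hρ1).const_mul ‖WeakDual.toStrongDual x.1‖
  rw [mul_zero] at h2
  exact absurd (ge_of_tendsto' h2 h1) (by norm_num)

/-- The function `|f - x f|²`. -/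
noncomputable def sqDist (x : GWAP G) (f : WAP G) : WAP G :=
  ⟨(f - extend f x • (⟨1, one_mem_WAP⟩ : WAP G) : WAP G) *
    star ((f - extend f x • (⟨1, one_mem_WAP⟩ : WAP G) : WAP G) : G →ᵇ ℂ),
    mul_mem_WAP (Submodule.coe_mem _) (star_mem_WAP (Submodule.coe_mem _))⟩

theorem sqDist_apply (x : GWAP G) (f : WAP G) (s : G) :
    (sqDist x f : G →ᵇ ℂ) s = ((‖(f : G →ᵇ ℂ) s - extend f x‖ ^ 2 : ℝ) : ℂ) := by
  have h : (sqDist x f : G →ᵇ ℂ) s = ((f : G →ᵇ ℂ) s - extend f x * 1) *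
    star ((f : G →ᵇ ℂ) s - extend f x * 1) := rfl
  rw [h, mul_one, RCLike.star_def, Complex.mul_conj, Complex.normSq_eq_norm_sq]

theorem extend_sqDist (x : GWAP G) (f : WAP G) : extend (sqDist x f) x = 0 := by
  have h := x.2.2 (f - extend f x • (⟨1, one_mem_WAP⟩ : WAP G))
    ⟨_, star_mem_WAP (Submodule.coe_mem (f - extend f x • (⟨1, one_mem_WAP⟩ : WAP G)))⟩
    (sqDist x f) rfl
  have h1 : x.1 (f - extend f x • (⟨1, one_mem_WAP⟩ : WAP G)) = 0 := by
    rw [map_sub, map_smul, map_one, smul_eq_mul, mul_one]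
    exact sub_self _
  rw [h1, zero_mul] at h
  exact h

/-- The conditions "`f` is close to `x f`" are directed, since a sum of squared distances controls
two of them at once. Each is satisfiable, for otherwise `sqDist x f` would be bounded below and yet
killed by `x`. An ultrafilter refining all of them represents `x`. -/
theorem exists_ofUltrafilter_eq (x : GWAP G) : ∃ p, ofUltrafilter p = x := by
  let 𝓕 : WAP G → Filter G := fun f => comap (f : G →ᵇ ℂ) (𝓝 (extend f x))
  have hdir : Directed (· ≥ ·) 𝓕 := by
    intro f g
    refine ⟨sqDist x f + sqDist x g, ?_⟩
    have h0 : extend (sqDist x f + sqDist x g) x = 0 := by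
      have : extend (sqDist x f + sqDist x g) x = extend (sqDist x f) x + extend (sqDist x g) x :=
        map_add _ _ _
      rw [this, extend_sqDist, extend_sqDist, add_zero]
    have hs : ∀ s, ((sqDist x f + sqDist x g : WAP G) : G →ᵇ ℂ) s =
        ((‖(f : G →ᵇ ℂ) s - extend f x‖ ^ 2 + ‖(g : G →ᵇ ℂ) s - extend g x‖ ^ 2 : ℝ) : ℂ) := by
      intro s
      rw [Complex.ofReal_add, ← sqDist_apply, ← sqDist_apply]
      rfl
    have ht : Tendsto (fun s => ‖(f : G →ᵇ ℂ) s - extend f x‖ ^ 2 +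
        ‖(g : G →ᵇ ℂ) s - extend g x‖ ^ 2) (𝓕 (sqDist x f + sqDist x g)) (𝓝 0) := by
      have h1 : Tendsto (fun s => ((sqDist x f + sqDist x g : WAP G) : G →ᵇ ℂ) s)
          (𝓕 (sqDist x f + sqDist x g)) (𝓝 0) := by
        rw [← h0]
        exact tendsto_comap
      have h2 := (Complex.continuous_re.tendsto _).comp h1
      simp only [Function.comp_def, hs, Complex.ofReal_re, Complex.zero_re] at h2
      exact h2
    have haux : ∀ (a b : G → ℝ) (l : Filter G), (∀ s, 0 ≤ a s) → (∀ s, 0 ≤ b s) →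
        Tendsto (fun s => a s ^ 2 + b s ^ 2) l (𝓝 0) → Tendsto a l (𝓝 0) := by
      intro a b l ha hb h
      have h1 := (Real.continuous_sqrt.tendsto _).comp h
      rw [Real.sqrt_zero] at h1
      refine squeeze_zero ha (fun s => ?_) h1
      exact Real.le_sqrt_of_sq_le (le_add_of_nonneg_right (sq_nonneg _))
    constructor
    · refine tendsto_iff_comap.1 (tendsto_iff_norm_sub_tendsto_zero.2 ?_)
      exact haux _ _ _ (fun _ => norm_nonneg _) (fun _ => norm_nonneg _) ht
    · refine tendsto_iff_comap.1 (tendsto_iff_norm_sub_tendsto_zero.2 ?_)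
      simp only [add_comm (‖(f : G →ᵇ ℂ) _ - extend f x‖ ^ 2)] at ht
      exact haux _ _ _ (fun _ => norm_nonneg _) (fun _ => norm_nonneg _) ht
  have hne : ∀ f, NeBot (𝓕 f) := by
    intro f
    rw [comap_neBot_iff]
    intro t ht
    obtain ⟨δ, hδ, hδt⟩ := Metric.mem_nhds_iff.1 ht
    by_contra! hcon
    refine extend_ne_zero (x := x) (sqDist_apply x f) (pow_pos hδ 2) (fun s => ?_)
      (extend_sqDist x f)
    have h1 : ¬ dist ((f : G →ᵇ ℂ) s) (extend f x) < δ := fun h => hcon s (hδt h)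
    rw [dist_eq_norm, not_lt] at h1
    exact pow_le_pow_left₀ hδ.le h1 2
  have : Nonempty G := ⟨1⟩
  have hneBot : NeBot (⨅ f, 𝓕 f) := iInf_neBot_of_directed hdir hne
  refine ⟨Ultrafilter.of (⨅ f, 𝓕 f), ext_extend fun f => ?_⟩
  exact ulim_eq (tendsto_iff_comap.2 ((Ultrafilter.of_le _).trans (iInf_le 𝓕 f)))

instance : CompactSpace (GWAP G) := by
  have h : range (ofUltrafilter : Ultrafilter G → GWAP G) = univ :=
    eq_univ_of_forall exists_ofUltrafilter_eq
  exact ⟨h ▸ isCompact_range continuous_ofUltrafilter⟩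

theorem mem_closure_iff {S : Set G} {x : GWAP G} :
    x ∈ closure (eval '' S) ↔ ∃ p : Ultrafilter G, S ∈ p ∧ ofUltrafilter p = x := by
  rw [mem_closure_iff_ultrafilter]
  constructor
  · rintro ⟨u, hu, hux⟩
    refine ⟨Ultrafilter.ofComapInfPrincipal hu, Ultrafilter.ofComapInfPrincipal_mem hu,
      ext_extend fun f => ulim_eq ?_⟩
    have h : Tendsto (extend f) u (𝓝 (extend f x)) :=
      ((continuous_extend f).tendsto x).mono_left hux
    rw [← Ultrafilter.ofComapInfPrincipal_eq_of_map hu] at h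
    exact h
  · rintro ⟨p, hp, rfl⟩
    refine ⟨p.map eval, image_mem_map hp, ?_⟩
    have h : Tendsto (fun g : G => (eval g : GWAP G)) p (𝓝 (ofUltrafilter p)) := by
      refine tendsto_subtype_rng.2 ?_
      refine (WeakBilin.tendsto_iff_forall_eval_tendsto _ ContinuousLinearMap.coe_injective).2
        fun f => ?_
      exact tendsto_ulim (f : G →ᵇ ℂ).exists_bound p
    exact h

/-- By uniform continuity, a small left translation changes `f` little uniformly in the other
variable. For a fixed left factor, continuity in `G^WAP` is that of the extension of a translate of
`f`. -/
theorem continuous_eval_mul [T2Space G] [LocallyCompactSpace G] :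
    Continuous fun y : G × GWAP G => (eval y.1 : GWAP G) * y.2 := by
  refine continuous_of_extend fun f => continuous_iff_continuousAt.2 fun ⟨v₀, x₀⟩ => ?_
  refine Metric.tendsto_nhds.2 fun ε hε => ?_
  obtain ⟨N, hN, hN2⟩ := exists_nhds_norm_sub_lt f.2 (half_pos hε)
  have h1 : ∀ᶠ y : G × GWAP G in 𝓝 (v₀, x₀), y.1 * v₀⁻¹ ∈ N := by
    have h : Tendsto (fun y : G × GWAP G => y.1 * v₀⁻¹) (𝓝 (v₀, x₀)) (𝓝 1) := by
      have := (continuous_fst.mul_const v₀⁻¹).tendsto ((v₀, x₀) : G × GWAP G)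
      simpa using this
    exact h hN
  have h2 : ∀ᶠ y : G × GWAP G in 𝓝 (v₀, x₀),
      dist (extend (WAP.translate v₀ f) y.2) (extend (WAP.translate v₀ f) x₀) < ε / 2 :=
    Metric.tendsto_nhds.1
      (((continuous_extend (WAP.translate v₀ f)).comp continuous_snd).tendsto (v₀, x₀)) _
      (half_pos hε)
  filter_upwards [h1, h2] with y hy1 hy2
  have h3 : ‖extend f (eval y.1 * y.2) - extend f (eval v₀ * y.2)‖ ≤ ε / 2 := by
    obtain ⟨p, hp⟩ := exists_ofUltrafilter_eq y.2
    rw [← hp, extend_eval_mul_ofUltrafilter, extend_eval_mul_ofUltrafilter]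
    refine ulim_sub_le ⟨_, fun _ => (f : G →ᵇ ℂ).norm_coe_le_norm _⟩
      ⟨_, fun _ => (f : G →ᵇ ℂ).norm_coe_le_norm _⟩ (Eventually.of_forall fun t => ?_)
    have := hN2 _ hy1 (v₀ * t)
    rw [← mul_assoc, inv_mul_cancel_right] at this
    exact this.le
  have h4 : ∀ x : GWAP G, extend (WAP.translate v₀ f) x = extend f (eval v₀ * x) := by
    intro x
    obtain ⟨p, rfl⟩ := exists_ofUltrafilter_eq x
    rfl
  rw [h4, h4] at hy2
  rw [← dist_eq_norm] at h3
  exact (dist_triangle _ _ _).trans_lt (by linarith)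

end GWAP

end Compactification

/-! ### Free ultrafilters and translation-compact sets -/

section Translates

variable {G : Type*} [Group G]

theorem mem_inv_singleton_mul {A : Set G} {b t : G} : t ∈ ({b⁻¹} : Set G) * A ↔ b * t ∈ A := by
  rw [singleton_mul, image_mul_left, inv_inv]; rfl

theorem mem_mul_inv_singleton {A : Set G} {b t : G} : t ∈ A * ({b⁻¹} : Set G) ↔ t * b ∈ A := by
  rw [mul_singleton, image_mul_right, inv_inv]; rfl

theorem mulL_map (q p : Ultrafilter G) (g : G) :
    (mulL q p).map (g * ·) = mulL (q.map (g * ·)) p := by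
  ext A
  rw [Ultrafilter.mem_map, mem_mulL, mem_mulL, Ultrafilter.coe_map, eventually_map]
  simp only [mem_preimage, mul_assoc]

theorem mulR_map (q p : Ultrafilter G) (g : G) :
    (mulR q p).map (g * ·) = mulR (q.map (g * ·)) p := by
  ext A
  rw [Ultrafilter.mem_map, mem_mulR, mem_mulR]
  simp only [mem_preimage, Ultrafilter.coe_map, eventually_map, mul_assoc]

end Translates

section Free

variable {G : Type*} [TopologicalSpace G]

/-- An ultrafilter is free if it contains no compact set. -/
def IsFree (p : Ultrafilter G) : Prop := ∀ K : Set G, IsCompact K → K ∉ p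

theorem isFree_of_le_cocompact {p : Ultrafilter G} (hp : (p : Filter G) ≤ cocompact G) :
    IsFree p := fun _ hK hKp =>
  Ultrafilter.compl_mem_iff_notMem.1 (hp hK.compl_mem_cocompact) hKp

theorem IsFree.notMem_of_relativelyCompact [T2Space G] {p : Ultrafilter G} (hp : IsFree p)
    {S : Set G} (hS : RelativelyCompact S) : S ∉ p :=
  fun h => hp _ hS (mem_of_superset h subset_closure)

theorem exists_le_nhds_of_not_isFree {p : Ultrafilter G} (hp : ¬ IsFree p) :
    ∃ g : G, (p : Filter G) ≤ 𝓝 g := by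
  simp only [IsFree, not_forall, not_not] at hp
  obtain ⟨K, hK, hKp⟩ := hp
  obtain ⟨g, -, hg⟩ := hK.ultrafilter_le_nhds p (le_principal_iff.2 hKp)
  exact ⟨g, hg⟩

theorem neBot_cocompact_inf_principal [T2Space G] {S : Set G} (hS : ¬ RelativelyCompact S) :
    NeBot (cocompact G ⊓ 𝓟 S) := by
  rw [inf_principal_neBot_iff]
  intro U hU
  obtain ⟨K, hK, hKU⟩ := mem_cocompact.1 hU
  by_contra hcon
  refine hS (hK.closure_of_subset fun x hx => ?_)
  by_contra hxK
  exact hcon ⟨x, hKU hxK, hx⟩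

theorem exists_isFree_mem [T2Space G] {S : Set G} (hS : ¬ RelativelyCompact S) :
    ∃ p : Ultrafilter G, IsFree p ∧ S ∈ p := by
  have := neBot_cocompact_inf_principal hS
  refine ⟨Ultrafilter.of (cocompact G ⊓ 𝓟 S),
    isFree_of_le_cocompact ((Ultrafilter.of_le _).trans inf_le_left), ?_⟩
  exact (Ultrafilter.of_le _).trans inf_le_right (mem_principal_self S)

theorem exists_isFree_forall_mem [T2Space G] [Nonempty G] {ι : Type*} (L : Set ι) (𝒜 : ι → Set G)
    (h : ∀ F : Finset ι, (F : Set ι) ⊆ L → ¬ RelativelyCompact (⋂ b ∈ F, 𝒜 b)) :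
    ∃ p : Ultrafilter G, IsFree p ∧ ∀ b ∈ L, 𝒜 b ∈ p := by
  classical
  let 𝓕 : {F : Finset ι // (F : Set ι) ⊆ L} → Filter G := fun F =>
    cocompact G ⊓ 𝓟 (⋂ b ∈ F.1, 𝒜 b)
  have hdir : Directed (· ≥ ·) 𝓕 := by
    rintro ⟨F, hF⟩ ⟨F', hF'⟩
    refine ⟨⟨F ∪ F', by rw [Finset.coe_union]; exact union_subset hF hF'⟩, ?_, ?_⟩
    · exact inf_le_inf_left _ (principal_mono.2
        (biInter_subset_biInter_left fun b hb => Finset.mem_union_left _ hb))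
    · exact inf_le_inf_left _ (principal_mono.2
        (biInter_subset_biInter_left fun b hb => Finset.mem_union_right _ hb))
  have hne : NeBot (⨅ F, 𝓕 F) := iInf_neBot_of_directed hdir fun F =>
    neBot_cocompact_inf_principal (h F.1 F.2)
  refine ⟨Ultrafilter.of (⨅ F, 𝓕 F), isFree_of_le_cocompact ?_, fun b hb => ?_⟩
  · exact (Ultrafilter.of_le _).trans ((iInf_le 𝓕 ⟨∅, by simp⟩).trans inf_le_left)
  · have h1 : (Ultrafilter.of (⨅ F, 𝓕 F) : Filter G) ≤ 𝓟 (𝒜 b) := by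
      refine (Ultrafilter.of_le _).trans ((iInf_le 𝓕 ⟨{b}, by simpa using hb⟩).trans
        (inf_le_right.trans ?_))
      simp
    exact h1 (mem_principal_self _)

theorem isFree_map {X : Type*} [TopologicalSpace X] {p : Ultrafilter G} (hp : IsFree p)
    (e : G ≃ₜ X) : IsFree (p.map e) := fun K hK hKp =>
  hp (e ⁻¹' K) (e.isCompact_preimage.2 hK) hKp

variable [Group G]

/-- If `A ∈ mulL q p`, the elements `s` with `s * t ∈ A` for `p`-almost all `t` form a set in `q`,
and any finite intersection of their translates of `A` is in `p`. Conversely, a set `L` without a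
suitable finite subset yields a free `p` containing all `b⁻¹A`, `b ∈ L`, and `L` itself lies in some
free `q`. -/
theorem rightTranslationCompact_iff [T2Space G] {A : Set G} :
    RightTranslationCompact A ↔ ∀ q p : Ultrafilter G, IsFree q → IsFree p → A ∉ mulL q p := by
  constructor
  · intro h q p hq hp hA
    obtain ⟨F, hFL, hF⟩ := h {s | ∀ᶠ t in p, s * t ∈ A}
      fun hL => hq.notMem_of_relativelyCompact hL hA
    refine hp.notMem_of_relativelyCompact hF ((Filter.biInter_finset_mem F).2 fun b hb => ?_)
    exact Filter.Eventually.mono (hFL hb) fun t ht => mem_inv_singleton_mul.2 ht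
  · intro h L hL
    by_contra! hcon
    obtain ⟨q, hq, hLq⟩ := exists_isFree_mem hL
    obtain ⟨p, hp, hpA⟩ := exists_isFree_forall_mem L (fun b => {b⁻¹} * A) hcon
    refine h q p hq hp (mem_mulL.2 (mem_of_superset hLq fun b hb => ?_))
    exact Filter.Eventually.mono (hpA b hb) fun t ht => mem_inv_singleton_mul.1 ht

theorem leftTranslationCompact_iff [T2Space G] {A : Set G} :
    LeftTranslationCompact A ↔ ∀ q p : Ultrafilter G, IsFree q → IsFree p → A ∉ mulR q p := by
  constructor
  · intro h q p hq hp hA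
    obtain ⟨F, hFL, hF⟩ := h {t | ∀ᶠ s in q, s * t ∈ A}
      fun hL => hp.notMem_of_relativelyCompact hL hA
    refine hq.notMem_of_relativelyCompact hF ((Filter.biInter_finset_mem F).2 fun b hb => ?_)
    exact Filter.Eventually.mono (hFL hb) fun t ht => mem_mul_inv_singleton.2 ht
  · intro h L hL
    by_contra! hcon
    obtain ⟨p, hp, hLp⟩ := exists_isFree_mem hL
    obtain ⟨q, hq, hqA⟩ := exists_isFree_forall_mem L (fun b => A * {b⁻¹}) hcon
    refine h q p hq hp (mem_mulR.2 (mem_of_superset hLp fun b hb => ?_))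
    exact Filter.Eventually.mono (hqA b hb) fun t ht => mem_mul_inv_singleton.1 ht

theorem translationCompact_iff [T2Space G] {A : Set G} :
    TranslationCompact A ↔ ∀ q p : Ultrafilter G, IsFree q → IsFree p →
      A ∉ mulL q p ∧ A ∉ mulR q p := by
  rw [TranslationCompact, leftTranslationCompact_iff, rightTranslationCompact_iff]
  exact ⟨fun h q p hq hp => ⟨h.2 q p hq hp, h.1 q p hq hp⟩,
    fun h => ⟨fun q p hq hp => (h q p hq hp).2, fun q p hq hp => (h q p hq hp).1⟩⟩

variable [IsTopologicalGroup G]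

theorem IsFree.map_mul_left {p : Ultrafilter G} (hp : IsFree p) (v : G) :
    IsFree (p.map (v * ·)) := isFree_map hp (Homeomorph.mulLeft v)

theorem isCompact_translationCompact [T2Space G] {K : Set G} (hK : IsCompact K) :
    TranslationCompact K := by
  rw [translationCompact_iff]
  refine fun q p hq hp => ⟨fun h => ?_, fun h => ?_⟩
  · obtain ⟨s, hs⟩ := (mem_mulL.1 h).exists
    exact hp.map_mul_left s K hK hs
  · obtain ⟨t, ht⟩ := (mem_mulR.1 h).exists
    exact isFree_map hq (Homeomorph.mulRight t) K hK ht

/-- Finitely many left translates of `V` cover `B`, and translates of free ultrafilters are free. -/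
theorem TranslationCompact.isCompact_mul [T2Space G] {V T B : Set G} (h : TranslationCompact (V * T))
    (hV : IsOpen V) (hV1 : (1 : G) ∈ V) (hB : IsCompact B) : TranslationCompact (B * T) := by
  rw [translationCompact_iff] at *
  obtain ⟨F, hF⟩ := compact_covered_by_mul_left_translates hB (V := V)
    ⟨1, by rwa [hV.interior_eq]⟩
  have hsub : B * T ⊆ ⋃ g ∈ (F : Set G), (g * ·) ⁻¹' (V * T) := by
    rintro _ ⟨b, hb, t, ht, rfl⟩
    obtain ⟨g, hg, hgb⟩ := mem_iUnion₂.1 (hF hb)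
    refine mem_iUnion₂.2 ⟨g, hg, g * b, hgb, t, ht, ?_⟩
    exact mul_assoc _ _ _
  refine fun q p hq hp => ⟨fun h1 => ?_, fun h1 => ?_⟩
  · obtain ⟨g, -, hg⟩ := (Ultrafilter.finite_biUnion_mem_iff F.finite_toSet).1
      (mem_of_superset h1 hsub)
    rw [← Ultrafilter.mem_map, mulL_map] at hg
    exact (h _ p (hq.map_mul_left g) hp).1 hg
  · obtain ⟨g, -, hg⟩ := (Ultrafilter.finite_biUnion_mem_iff F.finite_toSet).1
      (mem_of_superset h1 hsub)
    rw [← Ultrafilter.mem_map, mulR_map] at hg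
    exact (h _ p (hq.map_mul_left g) hp).2 hg

/-! ### Uniformly continuous functions -/

theorem LUC.continuous {f : G → ℂ} (hf : f ∈ LUC G) : Continuous f := by
  rw [continuous_iff_continuousAt]
  intro x
  refine Metric.tendsto_nhds.2 fun ε hε => ?_
  obtain ⟨N, hN, hN2⟩ := hf.2 ε hε
  have h : Tendsto (fun y => y * x⁻¹) (𝓝 x) (𝓝 1) := by
    have := (continuous_mul_const x⁻¹).tendsto x
    rwa [mul_inv_cancel] at this
  exact mem_of_superset (h hN) fun y hy => by simpa [dist_eq_norm] using hN2 y x hy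

/-- A uniformly continuous function whose support is translation-compact is weakly almost periodic. -/
theorem UC.exists_mem_WAP [T2Space G] {f : G → ℂ} (hf : f ∈ UC G) {A : Set G}
    (hA : TranslationCompact A) (hfA : Function.support f ⊆ A) : f ∈ WAPFun G := by
  rw [translationCompact_iff] at hA
  obtain ⟨C, hC⟩ := hf.1.1
  have hc := LUC.continuous hf.1
  have hb : ∃ C : ℝ, ∀ x, ‖f x‖ ≤ C := ⟨C, hC⟩
  refine ⟨⟨BoundedContinuousFunction.ofNormedAddCommGroup f hc C hC,
    mem_WAP_iff.2 fun q p => ?_⟩, fun _ => rfl⟩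
  change ulim (mulL q p) f = ulim (mulR q p) f
  by_cases hq : IsFree q
  · by_cases hp : IsFree p
    · have h0 : ∀ r : Ultrafilter G, A ∉ r → ulim r f = 0 := by
        intro r hr
        rw [← ulim_const r 0]
        refine ulim_congr ⟨0, fun _ => by simp⟩ ?_
        filter_upwards [Ultrafilter.compl_mem_iff_notMem.2 hr] with x hx
        by_contra h
        exact hx (hfA h)
      rw [h0 _ (hA q p hq hp).1, h0 _ (hA q p hq hp).2]
    -- When `p` converges to `t₀`, the functions `f (s * t)` approach `f (s * t₀)` uniformly in `s`
    -- by membership in `RUC(G)`, so the limits can be exchanged. The case where `q` converges uses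
    -- `LUC(G)` symmetrically.
    · obtain ⟨t₀, ht₀⟩ := exists_le_nhds_of_not_isFree hp
      rw [ulim_mulL q p hb, ulim_mulR q p hb]
      have h1 : ∀ s, (ulim p fun t => f (s * t)) = f (s * t₀) := fun s =>
        ulim_eq (((hc.comp (continuous_const_mul s)).tendsto t₀).mono_left ht₀)
      simp only [h1]
      refine (ulim_eq (Metric.tendsto_nhds.2 fun ε hε => ?_)).symm
      obtain ⟨N, hN, hN2⟩ := hf.2.2 (ε / 2) (half_pos hε)
      have h2 : Tendsto (fun t => t₀⁻¹ * t) p (𝓝 1) := by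
        have := ((continuous_const_mul t₀⁻¹).tendsto t₀).mono_left ht₀
        rwa [inv_mul_cancel] at this
      filter_upwards [h2 hN] with t ht
      rw [dist_comm, dist_eq_norm]
      refine (ulim_sub_le ⟨C, fun _ => hC _⟩ ⟨C, fun _ => hC _⟩
        (Eventually.of_forall fun s => (hN2 (s * t₀) (s * t) ?_).le)).trans_lt (half_lt_self hε)
      rwa [mul_inv_rev, mul_assoc, inv_mul_cancel_left]
  · obtain ⟨s₀, hs₀⟩ := exists_le_nhds_of_not_isFree hq
    rw [ulim_mulL q p hb, ulim_mulR q p hb]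
    have h1 : ∀ t, (ulim q fun s => f (s * t)) = f (s₀ * t) := fun t =>
      ulim_eq (((hc.comp (continuous_mul_const t)).tendsto s₀).mono_left hs₀)
    simp only [h1]
    refine ulim_eq (Metric.tendsto_nhds.2 fun ε hε => ?_)
    obtain ⟨N, hN, hN2⟩ := hf.1.2 (ε / 2) (half_pos hε)
    have h2 : Tendsto (fun s => s * s₀⁻¹) q (𝓝 1) := by
      have := ((continuous_mul_const s₀⁻¹).tendsto s₀).mono_left hs₀
      rwa [mul_inv_cancel] at this
    filter_upwards [h2 hN] with s hs
    rw [dist_eq_norm]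
    refine (ulim_sub_le ⟨C, fun _ => hC _⟩ ⟨C, fun _ => hC _⟩
      (Eventually.of_forall fun t => (hN2 (s * t) (s₀ * t) ?_).le)).trans_lt (half_lt_self hε)
    rwa [mul_inv_rev, mul_assoc, mul_inv_cancel_left]

end Free

/-! ### Bump functions, uniform continuity from local estimates, and the points of `G*` -/

section Bump

variable {G : Type*} [TopologicalSpace G]

theorem exists_bump [T2Space G] [LocallyCompactSpace G] {K O : Set G} (hK : IsCompact K)
    (hO : IsOpen O) (hKO : K ⊆ O) :
    ∃ (φ : G → ℂ) (C : Set G), Continuous φ ∧ IsCompact C ∧ C ⊆ O ∧ Function.support φ ⊆ C ∧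
      (∀ x ∈ K, φ x = 1) ∧ ∀ x, ‖φ x‖ ≤ 1 := by
  obtain ⟨f, h1, h2, h3, h4⟩ := exists_continuousMap_one_of_isCompact_subset_isOpen hK hO hKO
  refine ⟨fun x => f x, tsupport f, Complex.continuous_ofReal.comp f.continuous, h2, h3, ?_, ?_,
    fun x => ?_⟩
  · intro x hx
    refine subset_closure fun h0 => hx ?_
    simp [h0]
  · intro x hx
    simp [h1 hx]
  · rw [Complex.norm_real, Real.norm_of_nonneg (h4 x).1]
    exact (h4 x).2

theorem exists_bound_of_support {φ : G → ℂ} (hφ : Continuous φ) {K : Set G} (hK : IsCompact K)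
    (hs : Function.support φ ⊆ K) : ∃ C : ℝ, 0 ≤ C ∧ ∀ x, ‖φ x‖ ≤ C := by
  obtain ⟨C, hC⟩ := hK.exists_bound_of_continuousOn hφ.continuousOn
  refine ⟨max C 0, le_max_right _ _, fun x => ?_⟩
  by_cases hx : x ∈ K
  · exact (hC x hx).trans (le_max_left _ _)
  · have : φ x = 0 := by
      by_contra h
      exact hx (hs h)
    simp [this]

variable [Group G] [IsTopologicalGroup G]

/-- Two points outside `S` give the same value `0`, so one of the points may be taken in `S`;
inversion near the identity covers either choice. -/
theorem mem_UC_of_local {f : G → ℂ} {S : Set G} (hb : ∃ C : ℝ, ∀ s, ‖f s‖ ≤ C)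
    (hS : Function.support f ⊆ S)
    (hl : ∀ ε : ℝ, 0 < ε → ∀ᶠ n in 𝓝 (1 : G), ∀ s ∈ S, ‖f (n * s) - f s‖ < ε)
    (hr : ∀ ε : ℝ, 0 < ε → ∀ᶠ n in 𝓝 (1 : G), ∀ s ∈ S, ‖f (s * n) - f s‖ < ε) : f ∈ UC G := by
  have hinv : Tendsto (fun n : G => n⁻¹) (𝓝 1) (𝓝 1) := by
    simpa using (continuous_inv (G := G)).tendsto 1
  have h0 : ∀ s ∉ S, f s = 0 := fun s hs => by
    by_contra h
    exact hs (hS h)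
  constructor
  · refine ⟨hb, fun ε hε => ⟨_, (hl ε hε).and (hinv.eventually (hl ε hε)), fun s t hst => ?_⟩⟩
    by_cases ht : t ∈ S
    · simpa using hst.1 t ht
    · by_cases hs : s ∈ S
      · rw [norm_sub_rev]
        simpa using hst.2 s hs
      · simpa [h0 s hs, h0 t ht] using hε
  · refine ⟨hb, fun ε hε => ⟨_, (hr ε hε).and (hinv.eventually (hr ε hε)), fun s t hst => ?_⟩⟩
    by_cases hs : s ∈ S
    · rw [norm_sub_rev]
      simpa using hst.1 s hs
    · by_cases ht : t ∈ S
      · simpa using hst.2 t ht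
      · simpa [h0 s hs, h0 t ht] using hε

theorem eventually_left_norm_sub_lt {φ : G → ℂ} (hφ : Continuous φ) {K : Set G} (hK : IsCompact K)
    {ε : ℝ} (hε : 0 < ε) : ∀ᶠ n in 𝓝 (1 : G), ∀ u ∈ K, ‖φ (n * u) - φ u‖ < ε := by
  refine hK.eventually_forall_of_forall_eventually fun u _ => ?_
  have hc : Continuous fun z : G × G => ‖φ (z.1 * z.2) - φ z.2‖ := by fun_prop
  exact hc.continuousAt.eventually_lt_const (by simpa using hε)

theorem eventually_right_norm_sub_lt {φ : G → ℂ} (hφ : Continuous φ) {K : Set G}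
    (hK : IsCompact K) {ε : ℝ} (hε : 0 < ε) :
    ∀ᶠ n in 𝓝 (1 : G), ∀ u ∈ K, ‖φ (u * n) - φ u‖ < ε := by
  refine hK.eventually_forall_of_forall_eventually fun u _ => ?_
  have hc : Continuous fun z : G × G => ‖φ (z.2 * z.1) - φ z.2‖ := by fun_prop
  exact hc.continuousAt.eventually_lt_const (by simpa using hε)

theorem eventually_left_mem {K O : Set G} (hK : IsCompact K) (hO : IsOpen O) (hKO : K ⊆ O) :
    ∀ᶠ n in 𝓝 (1 : G), ∀ u ∈ K, n * u ∈ O := by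
  refine hK.eventually_forall_of_forall_eventually fun u hu => ?_
  have hc : Continuous fun z : G × G => z.1 * z.2 := continuous_mul
  exact hc.continuousAt.eventually_mem (hO.mem_nhds (by simpa using hKO hu))

theorem eventually_right_mem {K O : Set G} (hK : IsCompact K) (hO : IsOpen O) (hKO : K ⊆ O) :
    ∀ᶠ n in 𝓝 (1 : G), ∀ u ∈ K, u * n ∈ O := by
  refine hK.eventually_forall_of_forall_eventually fun u hu => ?_
  have hc : Continuous fun z : G × G => z.2 * z.1 := continuous_snd.mul continuous_fst
  exact hc.continuousAt.eventually_mem (hO.mem_nhds (by simpa using hKO hu))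

theorem mem_UC_of_support {φ : G → ℂ} (hφ : Continuous φ) {K : Set G} (hK : IsCompact K)
    (hs : Function.support φ ⊆ K) : φ ∈ UC G := by
  obtain ⟨C, -, hC⟩ := exists_bound_of_support hφ hK hs
  exact mem_UC_of_local ⟨C, hC⟩ hs (fun ε hε => eventually_left_norm_sub_lt hφ hK hε)
    (fun ε hε => eventually_right_norm_sub_lt hφ hK hε)

/-- The points of `G*` are those given by the free ultrafilters. -/
theorem GWAP.ofUltrafilter_mem_remainder_iff [T2Space G] [LocallyCompactSpace G]
    {p : Ultrafilter G} : GWAP.ofUltrafilter p ∈ GWAP.remainder G ↔ IsFree p := by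
  constructor
  · intro h
    by_contra hp
    obtain ⟨g, hg⟩ := exists_le_nhds_of_not_isFree hp
    exact h ⟨g, (GWAP.ofUltrafilter_eq_eval hg).symm⟩
  · rintro hp ⟨g, hg⟩
    -- A compactly supported bump at `g` is weakly almost periodic. It takes the value `1` at `g`
    -- and has limit `0` along every free ultrafilter.
    obtain ⟨φ, C, hφ, hC, -, hs, h1, -⟩ := exists_bump (isCompact_singleton (x := g)) isOpen_univ
      (subset_univ _)
    obtain ⟨h, hh⟩ := UC.exists_mem_WAP (mem_UC_of_support hφ hC hs)
      (isCompact_translationCompact hC) hs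
    have h2 : GWAP.extend h (GWAP.ofUltrafilter p) = 0 := by
      rw [GWAP.extend_ofUltrafilter, ← ulim_const p 0]
      refine ulim_congr ⟨0, fun _ => by simp⟩ ?_
      filter_upwards [Ultrafilter.compl_mem_iff_notMem.2 (hp C hC)] with x hx
      rw [hh]
      by_contra h
      exact hx (hs h)
    rw [← hg, GWAP.extend_eval, hh, h1 g rfl] at h2
    exact one_ne_zero h2

/-- If `C` is compact, then the closure of `C * T` is the product of `C` and of the closure of
`T`. -/
theorem GWAP.exists_eval_mul_of_mem [T2Space G] [LocallyCompactSpace G] {C T : Set G}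
    (hC : IsCompact C) {p : Ultrafilter G} (hp : C * T ∈ p) :
    ∃ v ∈ C, ∃ r : Ultrafilter G, T ∈ r ∧
      GWAP.ofUltrafilter p = GWAP.eval v * GWAP.ofUltrafilter r := by
  have hK : IsCompact (C ×ˢ closure (GWAP.eval '' T : Set (GWAP G))) :=
    hC.prod isClosed_closure.isCompact
  have hK2 := (hK.image GWAP.continuous_eval_mul).isClosed
  have h1 : GWAP.ofUltrafilter p ∈ closure (GWAP.eval '' (C * T) : Set (GWAP G)) :=
    GWAP.mem_closure_iff.2 ⟨p, hp, rfl⟩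
  have h2 : (GWAP.eval '' (C * T) : Set (GWAP G)) ⊆
      (fun y : G × GWAP G => (GWAP.eval y.1 : GWAP G) * y.2) ''
        (C ×ˢ closure (GWAP.eval '' T : Set (GWAP G))) := by
    rintro _ ⟨_, ⟨c, hc, t, ht, rfl⟩, rfl⟩
    exact ⟨(c, GWAP.eval t), ⟨hc, subset_closure ⟨t, ht, rfl⟩⟩, (GWAP.eval_mul c t).symm⟩
  obtain ⟨⟨v, y⟩, ⟨hv, hy⟩, hvy⟩ := closure_minimal h2 hK2 h1
  obtain ⟨r, hr, rfl⟩ := GWAP.mem_closure_iff.1 hy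
  exact ⟨v, hv, r, hr, hvy.symm⟩

end Bump

/-! ### The functions `1_{T,φ}`, with coefficients -/

section WeightedSum

variable {G : Type*} [Group G]

/-- The function with value `∑ t ∈ T, c t * φ (s * t⁻¹)` at `s`. -/
noncomputable def weightedSum (T : Set G) (c φ : G → ℂ) (s : G) : ℂ :=
  ∑ᶠ t ∈ T, c t * φ (s * t⁻¹)

theorem oneTranslate_eq (T : Set G) (φ : G → ℂ) : oneTranslate T φ = weightedSum T 1 φ := by
  ext s
  simp [oneTranslate, weightedSum]

/-- A second non-zero term would put `u * t` in two of the disjoint sets `O * {x}`. -/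
theorem weightedSum_mul {O T : Set G} (hO : RightUniformlyDiscrete O T) {φ : G → ℂ}
    (hφ : Function.support φ ⊆ O) (c : G → ℂ) {u t : G} (hu : u ∈ O) (ht : t ∈ T) :
    weightedSum T c φ (u * t) = c t * φ u := by
  rw [weightedSum, finsum_eq_single _ t]
  · simp [ht]
  · intro x hx
    by_cases hxT : x ∈ T
    · have h0 : φ (u * t * x⁻¹) = 0 := by
        by_contra h
        have h1 : u * t ∈ O * {x} := ⟨_, hφ h, x, rfl, inv_mul_cancel_right _ _⟩
        exact Set.disjoint_left.1 (hO x hxT t ht hx) h1 ⟨u, hu, t, rfl, rfl⟩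
      simp [h0]
    · simp [hxT]

theorem oneTranslate_mul {O T : Set G} (hO : RightUniformlyDiscrete O T) {φ : G → ℂ}
    (hφ : Function.support φ ⊆ O) {u t : G} (hu : u ∈ O) (ht : t ∈ T) :
    oneTranslate T φ (u * t) = φ u := by
  rw [oneTranslate_eq, weightedSum_mul hO hφ _ hu ht, Pi.one_apply, one_mul]

theorem weightedSum_eq_zero {C T : Set G} {φ : G → ℂ} (hφ : Function.support φ ⊆ C) (c : G → ℂ)
    {s : G} (hs : s ∉ C * T) : weightedSum T c φ s = 0 := by
  refine finsum_mem_eq_zero_of_forall_eq_zero fun t ht => ?_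
  have h0 : φ (s * t⁻¹) = 0 := by
    by_contra h
    exact hs ⟨_, hφ h, t, ht, inv_mul_cancel_right _ _⟩
  rw [h0, mul_zero]

theorem support_weightedSum {C T : Set G} {φ : G → ℂ} (hφ : Function.support φ ⊆ C) (c : G → ℂ) :
    Function.support (weightedSum T c φ) ⊆ C * T := fun _ hs => by
  by_contra h
  exact hs (weightedSum_eq_zero hφ c h)

theorem RightUniformlyDiscrete.mono {U U' T : Set G} [TopologicalSpace G]
    (h : RightUniformlyDiscrete U T) (hU : U' ⊆ U) : RightUniformlyDiscrete U' T :=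
  fun s hs t ht hst => (h s hs t ht hst).mono (mul_subset_mul_right hU) (mul_subset_mul_right hU)

/-- The disjoint pieces `O * {t}` reduce both estimates to `φ`. Left translation acts on the factor
`u` of `u * t`. Right translation by `n` replaces `u` by `u * (t * n * t⁻¹)`, and the E-set
condition makes the conjugates small uniformly in `t`. -/
theorem weightedSum_mem_UC [TopologicalSpace G] [IsTopologicalGroup G] {C O T : Set G}
    (hT : IsESet T) (hC : IsCompact C) (hO : IsOpen O) (hCO : C ⊆ O)
    (hOT : RightUniformlyDiscrete O T) {φ : G → ℂ} (hφ : Continuous φ)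
    (hs : Function.support φ ⊆ C) {c : G → ℂ} {M : ℝ} (hM : 0 ≤ M) (hc : ∀ t ∈ T, ‖c t‖ ≤ M) :
    weightedSum T c φ ∈ UC G := by
  obtain ⟨B, hB0, hB⟩ := exists_bound_of_support hφ hC hs
  have hval := fun {u t : G} (hu : u ∈ O) (ht : t ∈ T) =>
    weightedSum_mul hOT (hs.trans hCO) c hu ht
  have hsmall : ∀ {ε : ℝ}, 0 < ε → ∀ {u u' t : G}, u ∈ O → u' ∈ O → t ∈ T →
      ‖φ u - φ u'‖ < ε / (M + 1) →
      ‖weightedSum T c φ (u * t) - weightedSum T c φ (u' * t)‖ < ε := by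
    intro ε hε u u' t hu hu' ht h
    rw [hval hu ht, hval hu' ht, ← mul_sub, norm_mul]
    rw [lt_div_iff₀ (by linarith)] at h
    have h1 := mul_le_mul_of_nonneg_right (hc t ht) (norm_nonneg (φ u - φ u'))
    rcases (norm_nonneg (φ u - φ u')).eq_or_lt with h2 | h2
    · rw [← h2, mul_zero]; exact hε
    · nlinarith
  refine mem_UC_of_local (S := C * T) ⟨M * B, fun s => ?_⟩ (support_weightedSum hs c) ?_ ?_
  · by_cases h : s ∈ C * T
    · obtain ⟨u, hu, t, ht, rfl⟩ := h
      change ‖weightedSum T c φ (u * t)‖ ≤ _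
      rw [hval (hCO hu) ht, norm_mul]
      exact mul_le_mul (hc t ht) (hB u) (norm_nonneg _) hM
    · rw [weightedSum_eq_zero hs c h, norm_zero]
      positivity
  · intro ε hε
    filter_upwards [eventually_left_norm_sub_lt hφ hC (ε := ε / (M + 1)) (by positivity),
      eventually_left_mem hC hO hCO] with n hn1 hn2
    rintro _ ⟨u, hu, t, ht, rfl⟩
    change ‖weightedSum T c φ (n * (u * t)) - weightedSum T c φ (u * t)‖ < ε
    rw [← mul_assoc]
    exact hsmall hε (hn2 u hu) (hCO hu) ht (hn1 u hu)
  · intro ε hε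
    have h := hT.2 _ ((eventually_right_norm_sub_lt hφ hC (ε := ε / (M + 1)) (by positivity)).and
      (eventually_right_mem hC hO hCO))
    filter_upwards [h] with n hn
    rintro _ ⟨u, hu, t, ht, rfl⟩
    obtain ⟨_, ⟨a, ha, k, hk, rfl⟩, b, hb, hkn⟩ := mem_iInter₂.1 hn t (Or.inl ht)
    rw [mem_singleton_iff] at ha hb
    have hkn' : t⁻¹ * k * t = n := by rw [← hkn, ha, hb]
    change ‖weightedSum T c φ (u * t * n) - weightedSum T c φ (u * t)‖ < ε
    have h1 : u * t * n = u * k * t := by rw [← hkn']; group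
    rw [h1]
    exact hsmall hε (hk.2 u hu) (hCO hu) ht (hk.1 u hu)

end WeightedSum

/-! ### Sets which are not translation-compact -/

section Diagonal

/-- Entries on and above the diagonal lie in `A`, while those below avoid the `B`-thickening of all
the former. The recursion works because each fresh `x` or `y` has to avoid only finitely many
compact conditions, all of which hold almost surely. -/
theorem exists_seq_diagonal {X Y G : Type*} [TopologicalSpace G] [Group G] [IsTopologicalGroup G]
    (μ : X → Y → G) (q : Ultrafilter X) (p : Ultrafilter Y)
    (hq : ∀ K : Set G, IsCompact K → ∀ y, ∀ᶠ x in q, μ x y ∉ K)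
    (hp : ∀ K : Set G, IsCompact K → ∀ x, ∀ᶠ y in p, μ x y ∉ K) {A B : Set G}
    (hA : ∀ᶠ x in q, ∀ᶠ y in p, μ x y ∈ A) (hB : IsCompact B) :
    ∃ (x : ℕ → X) (y : ℕ → Y), (∀ n m, n ≤ m → μ (x n) (y m) ∈ A) ∧
      ∀ m n k l, m < n → k ≤ l → μ (x n) (y m) ∉ B * {μ (x k) (y l)} := by
  classical
  -- A term carries its history of earlier pairs. The third clause constrains the new `x`; the
  -- fourth constrains the new `y`, also against the row of the new `x`.
  obtain ⟨z, hzP, hzr⟩ := exists_seq_of_forall_finset_exists (α := Finset (X × Y) × X × Y)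
    (fun z => (∀ᶠ y in p, μ z.2.1 y ∈ A) ∧
      (∀ a ∈ insert z.2.1 (z.1.image Prod.fst), μ a z.2.2 ∈ A) ∧
      (∀ h ∈ z.1, ∀ h' ∈ z.1, ∀ h'' ∈ z.1, μ z.2.1 h.2 ∉ B * {μ h'.1 h''.2}) ∧
      ∀ h ∈ z.1, ∀ a ∈ insert z.2.1 (z.1.image Prod.fst),
        ∀ b ∈ insert z.2.1 (z.1.image Prod.fst), μ a h.2 ∉ B * {μ b z.2.2})
    (fun z w => z.2 ∈ w.1) (by
      intro 𝒮 h𝒮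
      let H : Finset (X × Y) := 𝒮.image Prod.snd
      have h1 : ∀ᶠ x in q, ∀ h ∈ H, ∀ h' ∈ H, ∀ h'' ∈ H, μ x h.2 ∉ B * {μ h'.1 h''.2} :=
        (Finset.eventually_all H).2 fun h _ => (Finset.eventually_all H).2 fun h' _ =>
          (Finset.eventually_all H).2 fun h'' _ => hq _ (hB.mul isCompact_singleton) _
      obtain ⟨x, hxA, hx⟩ := (hA.and h1).exists
      have hgood : ∀ a ∈ insert x (H.image Prod.fst), ∀ᶠ y in p, μ a y ∈ A := by
        intro a ha
        rcases Finset.mem_insert.1 ha with rfl | ha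
        · exact hxA
        · obtain ⟨_, hb, rfl⟩ := Finset.mem_image.1 ha
          obtain ⟨w, hw, rfl⟩ := Finset.mem_image.1 hb
          exact (h𝒮 w hw).1
      have h2 : ∀ᶠ y in p, ∀ h ∈ H, ∀ a ∈ insert x (H.image Prod.fst),
          ∀ b ∈ insert x (H.image Prod.fst), μ a h.2 ∉ B * {μ b y} := by
        refine (Finset.eventually_all H).2 fun h _ => (Finset.eventually_all _).2 fun a _ =>
          (Finset.eventually_all _).2 fun b _ => ?_
        filter_upwards [hp (B⁻¹ * {μ a h.2}) (hB.inv.mul isCompact_singleton) b] with y hy hy2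
        obtain ⟨β, hβ, c, hc, hβc⟩ := hy2
        rw [mem_singleton_iff] at hc
        refine hy ⟨β⁻¹, inv_mem_inv.2 hβ, _, rfl, ?_⟩
        change β⁻¹ * μ a h.2 = _
        rw [← hβc, hc]
        exact inv_mul_cancel_left _ _
      obtain ⟨y, hyA, hy⟩ := (((Finset.eventually_all _).2 hgood).and h2).exists
      exact ⟨(H, x, y), ⟨hxA, hyA, hx, hy⟩, fun w hw => Finset.mem_image_of_mem _ hw⟩)
  have hmem : ∀ {k n}, k ≤ n → (z k).2.1 ∈ insert (z n).2.1 ((z n).1.image Prod.fst) := by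
    intro k n hkn
    rcases hkn.eq_or_lt with rfl | hkn
    · exact Finset.mem_insert_self _ _
    · exact Finset.mem_insert_of_mem (Finset.mem_image_of_mem _ (hzr k n hkn))
  refine ⟨fun n => (z n).2.1, fun n => (z n).2.2, fun n m hnm => (hzP m).2.1 _ (hmem hnm), ?_⟩
  intro m n k l hmn hkl
  -- The required avoidance was imposed when the later of the two was chosen: `x n` if `l < n`, and
  -- `y l` otherwise.
  rcases lt_or_ge l n with hln | hnl
  · exact (hzP n).2.2.1 _ (hzr m n hmn) _ (hzr k n (hkl.trans_lt hln)) _ (hzr l n hln)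
  · exact (hzP l).2.2.2 _ (hzr m l (hmn.trans_le hnl)) _ (hmem hnl) _ (hmem hkl)

variable {G : Type*} [TopologicalSpace G] [Group G] [IsTopologicalGroup G]

/-- Write the entries with `n ≤ m` as `v * τ` and let `T₁` be the set of these `τ`. Along the upper
iterated limit `v` converges to some `v₀`, so a function separating near `v₀` has limit close to
`1`. The lower entries avoid `K * T₁`, because `τ = v⁻¹ * a` with `v⁻¹` in `(closure V)⁻¹`. Hence
the other limit is close to `0`. -/
theorem false_of_diagonal {V T K : Set G} (hV : RelativelyCompact V)
    (H : ∀ T₁ ⊆ T, ∀ v ∈ closure V, ∃ f ∈ WAP G, ∃ N ∈ 𝓝 v,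
      (∀ g ∈ N * T₁, ‖f g - 1‖ ≤ 1 / 4) ∧ ∀ g ∉ K * T₁, ‖f g‖ ≤ 1 / 4)
    (a : ℕ → ℕ → G) (h1 : ∀ n m, n ≤ m → a n m ∈ V * T)
    (h2 : ∀ m n k l, m < n → k ≤ l → a n m ∉ K * (closure V)⁻¹ * {a k l})
    (hw : ∀ f ∈ WAP G,
      ulim ((hyperfilter ℕ).bind fun n => (hyperfilter ℕ).map fun m => a n m) f =
      ulim ((hyperfilter ℕ).bind fun m => (hyperfilter ℕ).map fun n => a n m) f) : False := by
  have hex : ∀ g : G, ∃ v τ : G, g ∈ V * T → v ∈ V ∧ τ ∈ T ∧ v * τ = g := by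
    intro g
    by_cases hg : g ∈ V * T
    · obtain ⟨v, hv, t, ht, h⟩ := hg
      exact ⟨v, t, fun _ => ⟨hv, ht, h⟩⟩
    · exact ⟨1, 1, fun h => absurd h hg⟩
  choose v τ hvτ using hex
  set r₁ : Ultrafilter G := (hyperfilter ℕ).bind fun n => (hyperfilter ℕ).map fun m => a n m
  set r₂ : Ultrafilter G := (hyperfilter ℕ).bind fun m => (hyperfilter ℕ).map fun n => a n m
  let T₁ : Set G := {t | ∃ n m, n ≤ m ∧ τ (a n m) = t}
  have hT₁ : T₁ ⊆ T := by
    rintro _ ⟨n, m, hnm, rfl⟩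
    exact (hvτ _ (h1 n m hnm)).2.1
  have hr₁ : ∀ᶠ g in r₁, ∃ n m, n ≤ m ∧ a n m = g := by
    refine Eventually.of_forall (f := (hyperfilter ℕ : Filter ℕ)) fun n => ?_
    exact ((eventually_ge_atTop n).filter_mono Nat.hyperfilter_le_atTop).mono
      fun m hm => ⟨n, m, hm, rfl⟩
  have hr₂ : ∀ᶠ g in r₂, ∃ n m, m < n ∧ a n m = g := by
    refine Eventually.of_forall (f := (hyperfilter ℕ : Filter ℕ)) fun m => ?_
    exact ((eventually_gt_atTop m).filter_mono Nat.hyperfilter_le_atTop).mono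
      fun n hn => ⟨n, m, hn, rfl⟩
  obtain ⟨v₀, hv₀, hlim⟩ := IsCompact.ultrafilter_le_nhds hV (r₁.map v)
    (le_principal_iff.2 (hr₁.mono fun g hg => by
      obtain ⟨n, m, hnm, rfl⟩ := hg
      exact subset_closure (hvτ _ (h1 n m hnm)).1))
  obtain ⟨f, hf, N, hN, hN1, hN2⟩ := H T₁ hT₁ v₀ hv₀
  have e1 : ulim r₁ f ∈ Metric.closedBall (1 : ℂ) (1 / 4) := by
    refine ulim_mem f.exists_bound Metric.isClosed_closedBall ?_
    have hvN : ∀ᶠ g in r₁, v g ∈ N := hlim hN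
    filter_upwards [hr₁, hvN] with g hg hgN
    rw [Metric.mem_closedBall, dist_eq_norm]
    refine hN1 g ⟨v g, hgN, τ g, ?_, ?_⟩
    · obtain ⟨n, m, hnm, rfl⟩ := hg
      exact ⟨n, m, hnm, rfl⟩
    · obtain ⟨n, m, hnm, rfl⟩ := hg
      exact (hvτ _ (h1 n m hnm)).2.2
  have e2 : ulim r₂ f ∈ Metric.closedBall (0 : ℂ) (1 / 4) := by
    refine ulim_mem f.exists_bound Metric.isClosed_closedBall ?_
    filter_upwards [hr₂] with g hg
    rw [mem_closedBall_zero_iff]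
    refine hN2 g ?_
    obtain ⟨n, m, hmn, rfl⟩ := hg
    rintro ⟨k, hk, _, ⟨i, j, hij, rfl⟩, h⟩
    obtain ⟨hv, -, hvt⟩ := hvτ _ (h1 i j hij)
    refine h2 m n i j hmn hij ⟨k * (v (a i j))⁻¹,
      ⟨k, hk, _, inv_mem_inv.2 (subset_closure hv), rfl⟩, _, rfl, ?_⟩
    rw [← h]
    change k * (v (a i j))⁻¹ * a i j = k * τ (a i j)
    nth_rewrite 2 [← hvt]
    group
  rw [hw f hf, Metric.mem_closedBall, dist_eq_norm] at e1
  rw [mem_closedBall_zero_iff] at e2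
  have h3 := norm_sub_norm_le (1 : ℂ) (ulim r₂ f)
  rw [norm_sub_rev, norm_one] at h3
  linarith

/-- If weakly almost periodic functions separate the pieces of `V * T` well enough, then `V * T` is
translation-compact. -/
theorem translationCompact_of_separation [T2Space G] {V T K : Set G} (hV : RelativelyCompact V)
    (hK : IsCompact K)
    (H : ∀ T₁ ⊆ T, ∀ v ∈ closure V, ∃ f ∈ WAP G, ∃ N ∈ 𝓝 v,
      (∀ g ∈ N * T₁, ‖f g - 1‖ ≤ 1 / 4) ∧ ∀ g ∉ K * T₁, ‖f g‖ ≤ 1 / 4) :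
    TranslationCompact (V * T) := by
  have hB : IsCompact (K * (closure V)⁻¹) := hK.mul (IsCompact.inv hV)
  have hl : ∀ {p : Ultrafilter G}, IsFree p → ∀ C : Set G, IsCompact C → ∀ x,
      ∀ᶠ y in p, x * y ∉ C := fun hp C hC x =>
    Ultrafilter.compl_mem_iff_notMem.2 (hp.map_mul_left x C hC)
  have hr : ∀ {p : Ultrafilter G}, IsFree p → ∀ C : Set G, IsCompact C → ∀ x,
      ∀ᶠ y in p, y * x ∉ C := fun hp C hC x =>
    Ultrafilter.compl_mem_iff_notMem.2 (isFree_map hp (Homeomorph.mulRight x) C hC)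
  refine translationCompact_iff.2 fun q p hq hp => ⟨fun hA => ?_, fun hA => ?_⟩
  · obtain ⟨x, y, h1, h2⟩ := exists_seq_diagonal (fun s t => s * t) q p (hr hq) (hl hp) hA hB
    refine false_of_diagonal hV H (fun n m => x n * y m) h1 h2 fun f hf => ?_
    exact mem_WAP_iff.1 hf ((hyperfilter ℕ).map x) ((hyperfilter ℕ).map y)
  · obtain ⟨x, y, h1, h2⟩ := exists_seq_diagonal (fun t s => s * t) p q (hl hp) (hr hq) hA hB
    refine false_of_diagonal hV H (fun n m => y m * x n) h1 h2 fun f hf => ?_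
    exact (mem_WAP_iff.1 hf ((hyperfilter ℕ).map y) ((hyperfilter ℕ).map x)).symm

/-- Left translation by `v⁻¹` carries a function separating near the identity to one separating near
`v`, and `closure V * closure V` absorbs the displacement. -/
theorem translationCompact_of_local_separation [T2Space G] {V T : Set G}
    (hV : RelativelyCompact V)
    (H : ∀ T₁ ⊆ T, ∃ h ∈ WAP G, (∃ N ∈ 𝓝 (1 : G), ∀ g ∈ N * T₁, ‖h g - 1‖ ≤ 1 / 4) ∧
      ∀ g ∉ V * T₁, ‖h g‖ ≤ 1 / 4) : TranslationCompact (V * T) := by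
  refine translationCompact_of_separation hV (K := closure V * closure V) (IsCompact.mul hV hV)
    fun T₁ hT₁ v hv => ?_
  obtain ⟨h, hh, ⟨N, hN, hN1⟩, hN2⟩ := H T₁ hT₁
  refine ⟨leftTranslate v⁻¹ h, leftTranslate_mem_WAP _ hh, (v⁻¹ * ·) ⁻¹' N, ?_, ?_, ?_⟩
  · have hc : Tendsto (v⁻¹ * ·) (𝓝 v) (𝓝 1) := by
      simpa using (continuous_const_mul v⁻¹).tendsto v
    exact hc hN
  · rintro _ ⟨n, hn, t, ht, rfl⟩
    exact hN1 _ ⟨v⁻¹ * n, hn, t, ht, mul_assoc _ _ _⟩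
  · intro g hg
    refine hN2 _ ?_
    rintro ⟨u, hu, t, ht, hut⟩
    refine hg ⟨v * u, ⟨v, hv, u, subset_closure hu, rfl⟩, t, ht, ?_⟩
    change v * u * t = g
    have : u * t = v⁻¹ * g := hut
    rw [mul_assoc, this, mul_inv_cancel_left]

end Diagonal

/-! ### The five conditions are equivalent -/

section Main

variable {G : Type*} [TopologicalSpace G] [Group G] {T U V : Set G}

theorem Admissible.rightUniformlyDiscrete (hV : Admissible U V) (hTU : RightUniformlyDiscrete U T) :
    RightUniformlyDiscrete (V * V) T := hTU.mono hV.2.2.2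

variable [IsTopologicalGroup G]

theorem closure_subset_mul_of_isOpen (hV : IsOpen V) (hV1 : (1 : G) ∈ V) :
    closure V ⊆ V * V := by
  intro x hx
  have hN : (fun a : G => a⁻¹ * x) ⁻¹' V ∈ 𝓝 x := by
    have hc : Continuous fun a : G => a⁻¹ * x := by fun_prop
    exact hc.continuousAt (hV.mem_nhds (by simpa using hV1))
  obtain ⟨a, ha, haV⟩ := mem_closure_iff_nhds.1 hx _ hN
  exact ⟨a, haV, a⁻¹ * x, ha, mul_inv_cancel_left _ _⟩

theorem GWAP.continuous_eval : Continuous (GWAP.eval : G → GWAP G) :=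
  GWAP.continuous_of_extend fun f => (f : G →ᵇ ℂ).continuous

theorem Admissible.closure_subset (hV : Admissible U V) : closure V ⊆ V * V :=
  closure_subset_mul_of_isOpen hV.1 hV.2.1

theorem Admissible.subset_mul (hV : Admissible U V) : V ⊆ V * V :=
  subset_closure.trans hV.closure_subset

variable (T) in
/-- The extension of `T → G^WAP` to the Stone–Čech compactification of `T`. -/
noncomputable def stoneCechToGWAP : StoneCech T → GWAP G :=
  stoneCechExtend (g := fun t : T => (GWAP.eval (t : G) : GWAP G))
    (GWAP.continuous_eval.comp continuous_subtype_val)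

theorem continuous_stoneCechToGWAP : Continuous (stoneCechToGWAP T) :=
  continuous_stoneCechExtend _

theorem stoneCechToGWAP_unit (t : T) : stoneCechToGWAP T (stoneCechUnit t) = GWAP.eval (t : G) :=
  stoneCechExtend_stoneCechUnit _ t

theorem range_stoneCechToGWAP :
    range (stoneCechToGWAP T) = closure (GWAP.eval '' T : Set (GWAP G)) := by
  have h0 : range (stoneCechToGWAP T ∘ stoneCechUnit) = GWAP.eval '' T := by
    have : stoneCechToGWAP T ∘ stoneCechUnit = fun t : T => (GWAP.eval (t : G) : GWAP G) :=
      funext stoneCechToGWAP_unit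
    rw [this, image_eq_range]
  refine Subset.antisymm ?_ ?_
  · rw [← h0, range_comp]
    exact continuous_stoneCechToGWAP.range_subset_closure_image_dense denseRange_stoneCechUnit
  · refine closure_minimal ?_ (isCompact_range continuous_stoneCechToGWAP).isClosed
    rw [← h0]
    exact range_comp_subset_range _ _

variable [T2Space G]

theorem weightedSum_mem_WAPFun (hT : IsESet T) (hTU : RightUniformlyDiscrete U T)
    (hV : Admissible U V) (h : TranslationCompact (V * T)) {φ : G → ℂ} (hφ : Continuous φ)
    {C : Set G} (hC : IsCompact C) (hCV : C ⊆ V * V) (hs : Function.support φ ⊆ C) {c : G → ℂ}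
    {M : ℝ} (hc : ∀ t ∈ T, ‖c t‖ ≤ M) (hM : 0 ≤ M) : weightedSum T c φ ∈ WAPFun G :=
  UC.exists_mem_WAP
    (weightedSum_mem_UC hT hC hV.1.mul_left hCV (hV.rightUniformlyDiscrete hTU) hφ hs hM hc)
    (h.isCompact_mul hV.1 hV.2.1 hC) (support_weightedSum hs c)

theorem oneTranslate_mem_WAPFun (hT : IsESet T) (hTU : RightUniformlyDiscrete U T)
    (hV : Admissible U V) (h : TranslationCompact (V * T)) {φ : G → ℂ} (hφ : Continuous φ)
    {C : Set G} (hC : IsCompact C) (hCV : C ⊆ V * V) (hs : Function.support φ ⊆ C) :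
    oneTranslate T φ ∈ WAPFun G := by
  rw [oneTranslate_eq]
  exact weightedSum_mem_WAPFun hT hTU hV h hφ hC hCV hs (M := 1) (fun t _ => by simp) zero_le_one

theorem condUC_of_translationCompact (h : TranslationCompact (V * T)) : CondUC T V :=
  fun _ hf hfs => UC.exists_mem_WAP hf h hfs

theorem condVanish_of_translationCompact (hT : IsESet T) (hTU : RightUniformlyDiscrete U T)
    [LocallyCompactSpace G] (hV : Admissible U V) (h : TranslationCompact (V * T)) :
    CondVanish T V := by
  intro φ hφ hs
  obtain ⟨f, hf⟩ := oneTranslate_mem_WAPFun hT hTU hV h (LUC.continuous hφ.1) hV.2.2.1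
    hV.closure_subset (hs.trans subset_closure)
  refine ⟨f, hf, ?_⟩
  rintro _ ⟨x, hx, y, hy, rfl⟩
  obtain ⟨q, rfl⟩ := GWAP.exists_ofUltrafilter_eq x
  obtain ⟨p, rfl⟩ := GWAP.exists_ofUltrafilter_eq y
  rw [GWAP.ofUltrafilter_mem_remainder_iff] at hx hy
  change GWAP.extend f (GWAP.ofUltrafilter q * GWAP.ofUltrafilter p) = 0
  rw [GWAP.ofUltrafilter_mul, GWAP.extend_ofUltrafilter, ← ulim_const (mulL q p) 0]
  refine ulim_congr ⟨0, fun _ => by simp⟩ ?_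
  filter_upwards [Ultrafilter.compl_mem_iff_notMem.2 (translationCompact_iff.1 h q p hx hy).1]
    with s hs'
  rw [hf, oneTranslate_eq, weightedSum_eq_zero hs _ hs']

/-- A bump `φ` with value `1` at the identity makes `1_{T,φ}` equal to `1` on `T`. Its extension is
then `1` on the closure of `T` but `0` on `G*G*`. -/
theorem closure_subset_of_condVanish [LocallyCompactSpace G] (hTU : RightUniformlyDiscrete U T)
    (hV : Admissible U V) (h : CondVanish T V) :
    closure (GWAP.eval '' T) ⊆ (GWAP.remainder G * GWAP.remainder G)ᶜ := by
  intro x hx hx2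
  obtain ⟨φ, C, hφ, hC, hCV, hs, h1, -⟩ := exists_bump (isCompact_singleton (x := (1 : G))) hV.1
    (singleton_subset_iff.2 hV.2.1)
  obtain ⟨f, hf, hf0⟩ := h φ (mem_UC_of_support hφ hC hs) (hs.trans hCV)
  obtain ⟨p, hp, rfl⟩ := GWAP.mem_closure_iff.1 hx
  have h2 : GWAP.extend f (GWAP.ofUltrafilter p) = 1 := by
    rw [GWAP.extend_ofUltrafilter, ← ulim_const p 1]
    refine ulim_congr ⟨1, fun _ => by simp⟩ ?_
    filter_upwards [hp] with t ht
    have := oneTranslate_mul (hV.rightUniformlyDiscrete hTU)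
      ((hs.trans hCV).trans hV.subset_mul) (hV.subset_mul hV.2.1) ht
    rw [one_mul, h1 1 rfl] at this
    rw [hf, this]
  rw [hf0 _ hx2] at h2
  exact zero_ne_one h2

/-- A free product containing `V * T` represents `v y` with `v` in the closure of `V` and `y` in
that of `T`. Multiplying by `v⁻¹`, which keeps the left factor in `G*`, would put `y` in `G*G*`. -/
theorem translationCompact_of_closure_subset [LocallyCompactSpace G] (hV : RelativelyCompact V)
    (h : closure (GWAP.eval '' T) ⊆ (GWAP.remainder G * GWAP.remainder G)ᶜ) :
    TranslationCompact (V * T) := by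
  have key : ∀ q p r : Ultrafilter G, IsFree q → IsFree p →
      GWAP.ofUltrafilter r = GWAP.ofUltrafilter (mulL q p) → V * T ∉ r := by
    intro q p r hq hp hr hVT
    obtain ⟨v, -, r', hr', hv⟩ := GWAP.exists_eval_mul_of_mem hV
      (mem_of_superset hVT (mul_subset_mul_right subset_closure))
    have h1 : (GWAP.ofUltrafilter r' : GWAP G) =
        GWAP.ofUltrafilter (q.map (v⁻¹ * ·)) * GWAP.ofUltrafilter p := by
      rw [hr, GWAP.eval_mul_ofUltrafilter] at hv
      rw [GWAP.ofUltrafilter_mul, ← mulL_map, ← GWAP.eval_mul_ofUltrafilter, hv,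
        GWAP.eval_mul_ofUltrafilter, Ultrafilter.map_map]
      have : ((v⁻¹ * ·) ∘ (v * ·) : G → G) = id := funext fun x => inv_mul_cancel_left v x
      rw [this, Ultrafilter.map_id]
    refine h (GWAP.mem_closure_iff.2 ⟨r', hr', rfl⟩) ⟨_, ?_, _, ?_, h1.symm⟩
    · exact GWAP.ofUltrafilter_mem_remainder_iff.2 (hq.map_mul_left _)
    · exact GWAP.ofUltrafilter_mem_remainder_iff.2 hp
  exact translationCompact_iff.2 fun q p hq hp =>
    ⟨key q p _ hq hp rfl, key q p _ hq hp (GWAP.ofUltrafilter_mulR q p)⟩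

/-- For a bump `φ` at `w` supported in a compact `C ⊆ W`, the extension of `1_{T,φ}` equals `1` at
`w y` and can be non-zero only on the product of `C` with the closure of `T`. -/
theorem isOpen_eval_mul_closure [LocallyCompactSpace G] (hT : IsESet T)
    (hTU : RightUniformlyDiscrete U T) (hV : Admissible U V) (h : TranslationCompact (V * T))
    {W : Set G} (hW : IsOpen W) (hWV : W ⊆ V) :
    IsOpen ((GWAP.eval '' W) * closure (GWAP.eval '' T) : Set (GWAP G)) := by
  rw [isOpen_iff_mem_nhds]
  rintro _ ⟨_, ⟨w, hw, rfl⟩, y, hy, rfl⟩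
  obtain ⟨r, hr, rfl⟩ := GWAP.mem_closure_iff.1 hy
  obtain ⟨φ, C, hφ, hC, hCW, hs, h1, -⟩ := exists_bump (isCompact_singleton (x := w)) hW
    (singleton_subset_iff.2 hw)
  have hCV : C ⊆ V * V := (hCW.trans hWV).trans hV.subset_mul
  obtain ⟨f, hf⟩ := oneTranslate_mem_WAPFun hT hTU hV h hφ hC hCV hs
  have hopen : IsOpen {x : GWAP G | GWAP.extend f x ≠ 0} :=
    isOpen_ne_fun (GWAP.continuous_extend f) continuous_const
  refine mem_of_superset (hopen.mem_nhds ?_) ?_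
  · have h2 : GWAP.extend f (GWAP.eval w * GWAP.ofUltrafilter r) = 1 := by
      rw [GWAP.extend_eval_mul_ofUltrafilter, ← ulim_const r 1]
      refine ulim_congr ⟨1, fun _ => by simp⟩ ?_
      filter_upwards [hr] with t ht
      rw [hf, oneTranslate_mul (hV.rightUniformlyDiscrete hTU) (hs.trans hCV)
        (hV.subset_mul (hWV hw)) ht, h1 w rfl]
    change GWAP.extend f (GWAP.eval w * GWAP.ofUltrafilter r) ≠ 0
    rw [h2]
    exact one_ne_zero
  · intro x hx
    obtain ⟨p, rfl⟩ := GWAP.exists_ofUltrafilter_eq x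
    have hp : C * T ∈ p := by
      by_contra hp
      refine hx ?_
      rw [GWAP.extend_ofUltrafilter, ← ulim_const p 0]
      refine ulim_congr ⟨0, fun _ => by simp⟩ ?_
      filter_upwards [Ultrafilter.compl_mem_iff_notMem.2 hp] with s hs'
      rw [hf, oneTranslate_eq, weightedSum_eq_zero hs _ hs']
    obtain ⟨v, hv, r', hr', hvr⟩ := GWAP.exists_eval_mul_of_mem hC hp
    rw [hvr]
    exact ⟨_, ⟨v, hCW hv, rfl⟩, _, GWAP.mem_closure_iff.2 ⟨r', hr', rfl⟩, rfl⟩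

theorem condOpen_of_translationCompact [LocallyCompactSpace G] (hT : IsESet T)
    (hTU : RightUniformlyDiscrete U T) (hV : Admissible U V) (h : TranslationCompact (V * T)) :
    CondOpen T V :=
  ⟨fun _ hW _ hWV => isOpen_eval_mul_closure hT hTU hV h hW hWV,
    closure_subset_of_condVanish hTU hV (condVanish_of_translationCompact hT hTU hV h)⟩

theorem translationCompact_of_condUC [LocallyCompactSpace G] (hT : IsESet T)
    (hTU : RightUniformlyDiscrete U T) (hV : Admissible U V) (h : CondUC T V) :
    TranslationCompact (V * T) := by
  classical
  refine translationCompact_of_local_separation hV.2.2.1 fun T₁ hT₁ => ?_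
  obtain ⟨φ, C, hφ, hC, hCV, hs, h1, -⟩ := exists_bump (isCompact_singleton (x := (1 : G))) hV.1
    (singleton_subset_iff.2 hV.2.1)
  have hsV := hs.trans hCV
  -- Weighting by the indicator of `T₁` produces a function in `UC(G)` supported in `V * T` which
  -- separates `T₁` from the rest of `T`.
  let c : G → ℂ := fun t => if t ∈ T₁ then 1 else 0
  have hc : ∀ t ∈ T, ‖c t‖ ≤ 1 := fun t _ => by
    by_cases ht : t ∈ T₁ <;> simp [c, ht]
  obtain ⟨f, hf⟩ := h _ (weightedSum_mem_UC hT hC hV.1 hCV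
    ((hV.rightUniformlyDiscrete hTU).mono hV.subset_mul) hφ hs zero_le_one hc)
    (support_weightedSum hsV c)
  have hval := fun {u t : G} (hu : u ∈ V) (ht : t ∈ T) =>
    weightedSum_mul ((hV.rightUniformlyDiscrete hTU).mono hV.subset_mul) hsV c hu ht
  refine ⟨f, f.2, ⟨{u | ‖φ u - 1‖ ≤ 1 / 4} ∩ V, ?_, ?_⟩, ?_⟩
  · refine inter_mem ?_ (hV.1.mem_nhds hV.2.1)
    have hcont : Continuous fun u => ‖φ u - 1‖ := (hφ.sub continuous_const).norm
    refine (hcont.continuousAt.eventually_lt_const ?_).mono fun u hu => le_of_lt hu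
    beta_reduce
    rw [h1 1 rfl]
    norm_num
  · rintro _ ⟨u, ⟨hu, huV⟩, t, ht, rfl⟩
    change ‖(f : G →ᵇ ℂ) (u * t) - 1‖ ≤ 1 / 4
    rw [hf, hval huV (hT₁ ht)]
    simpa [c, ht] using hu
  · intro g hg
    rw [hf]
    by_cases hgT : g ∈ V * T
    · obtain ⟨u, hu, t, ht, rfl⟩ := hgT
      have ht' : t ∉ T₁ := fun h => hg ⟨u, hu, t, h, rfl⟩
      change ‖weightedSum T c φ (u * t)‖ ≤ 1 / 4
      rw [hval hu ht]
      simp [c, ht']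
    · rw [weightedSum_eq_zero hsV c hgT]
      norm_num

theorem translationCompact_of_condProduct [LocallyCompactSpace G]
    (hTU : RightUniformlyDiscrete U T) (hV : Admissible U V) (h : CondProduct T V) :
    TranslationCompact (V * T) := by
  classical
  refine translationCompact_of_local_separation hV.2.2.1 fun T₁ hT₁ => ?_
  obtain ⟨F, ⟨k, hk⟩, hF⟩ := h.1 (fun t => if (t : G) ∈ T₁ then 1 else 0)
    ⟨1, fun t => by by_cases ht : (t : G) ∈ T₁ <;> simp [ht]⟩
  -- On `N * {t}` the interpolating function `k` stays within `1 / 8` of its value at `t`.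
  -- Multiplying by `1_{T,φ}`, with `φ` supported in `V ∩ N`, cuts it off elsewhere. Near `T₁` the
  -- total error is at most `1 / 8 + 1 / 16`.
  obtain ⟨N, hN, hN2⟩ := exists_nhds_norm_sub_lt k.2 (ε := 1 / 8) (by norm_num)
  obtain ⟨φ, C, hφ, hC, hCV, hs, h1, hφ1⟩ := exists_bump (isCompact_singleton (x := (1 : G)))
    (hV.1.inter isOpen_interior)
    (singleton_subset_iff.2 ⟨hV.2.1, mem_interior_iff_mem_nhds.2 hN⟩)
  have hsV := (hs.trans hCV).trans inter_subset_left
  obtain ⟨f, hf⟩ := h.2.1 φ (mem_UC_of_support hφ hC hs).1 (hsV.trans subset_closure)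
  have hval := fun {u t : G} (hu : u ∈ V) (ht : t ∈ T) =>
    oneTranslate_mul ((hV.rightUniformlyDiscrete hTU).mono hV.subset_mul) hsV hu ht
  have hkt : ∀ t ∈ T, (k : G →ᵇ ℂ) t = if t ∈ T₁ then 1 else 0 := fun t ht => by
    rw [hk, hF ⟨t, ht⟩]
  refine ⟨f * k, mul_mem_WAP f.2 k.2, ⟨{u | ‖φ u - 1‖ ≤ 1 / 16} ∩ (V ∩ N), ?_, ?_⟩, ?_⟩
  · refine inter_mem ?_ (inter_mem (hV.1.mem_nhds hV.2.1) hN)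
    have hcont : Continuous fun u => ‖φ u - 1‖ := (hφ.sub continuous_const).norm
    refine (hcont.continuousAt.eventually_lt_const ?_).mono fun u hu => le_of_lt hu
    beta_reduce
    rw [h1 1 rfl]
    norm_num
  · rintro _ ⟨u, ⟨hu, huV, huN⟩, t, ht, rfl⟩
    change ‖(f : G →ᵇ ℂ) (u * t) * (k : G →ᵇ ℂ) (u * t) - 1‖ ≤ 1 / 4
    have h2 := (hN2 u huN t).le
    rw [hkt t (hT₁ ht), if_pos ht] at h2
    rw [hf, hval huV (hT₁ ht)]
    have h3 : φ u * (k : G →ᵇ ℂ) (u * t) - 1 =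
        φ u * ((k : G →ᵇ ℂ) (u * t) - 1) + (φ u - 1) := by ring
    have h4 : ‖φ u * ((k : G →ᵇ ℂ) (u * t) - 1)‖ ≤ 1 * (1 / 8) := by
      rw [norm_mul]
      exact mul_le_mul (hφ1 u) h2 (norm_nonneg _) zero_le_one
    have hu' : ‖φ u - 1‖ ≤ 1 / 16 := hu
    rw [h3]
    refine (norm_add_le _ _).trans ?_
    linarith
  · intro g hg
    change ‖(f : G →ᵇ ℂ) g * (k : G →ᵇ ℂ) g‖ ≤ 1 / 4
    rw [hf]
    by_cases hgC : g ∈ C * T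
    · obtain ⟨u, hu, t, ht, rfl⟩ := hgC
      have huV := (hCV hu).1
      have ht' : t ∉ T₁ := fun h => hg ⟨u, huV, t, h, rfl⟩
      have h2 := (hN2 u (interior_subset (hCV hu).2) t).le
      rw [hkt t ht, if_neg ht', sub_zero] at h2
      change ‖oneTranslate T φ (u * t) * (k : G →ᵇ ℂ) (u * t)‖ ≤ 1 / 4
      rw [hval huV ht, norm_mul]
      have := mul_le_mul (hφ1 u) h2 (norm_nonneg _) zero_le_one
      linarith
    · rw [oneTranslate_eq, weightedSum_eq_zero hs _ hgC]
      norm_num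

theorem isInterpolationSet_of_translationCompact [LocallyCompactSpace G] (hT : IsESet T)
    (hTU : RightUniformlyDiscrete U T) (hV : Admissible U V) (h : TranslationCompact (V * T)) :
    IsInterpolationSet (WAPFun G) T := by
  classical
  rintro f ⟨M, hM⟩
  obtain ⟨φ, C, hφ, hC, hCV, hs, h1, -⟩ := exists_bump (isCompact_singleton (x := (1 : G))) hV.1
    (singleton_subset_iff.2 hV.2.1)
  have hCV' := hCV.trans hV.subset_mul
  let c : G → ℂ := fun t => if ht : t ∈ T then f ⟨t, ht⟩ else 0
  refine ⟨weightedSum T c φ, weightedSum_mem_WAPFun hT hTU hV h hφ hC hCV' hs (M := max M 0)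
    (fun t ht => ?_) (le_max_right _ _), fun t => ?_⟩
  · simp only [c, dif_pos ht]
    exact (hM _).trans (le_max_left _ _)
  · have := weightedSum_mul (hV.rightUniformlyDiscrete hTU) (hs.trans hCV') c
      (hV.subset_mul hV.2.1) t.2
    rw [one_mul, h1 1 rfl, mul_one] at this
    rw [this]
    simp [c]

theorem continuous_eval_mul_stoneCech [LocallyCompactSpace G] :
    Continuous fun y : G × StoneCech T => (GWAP.eval y.1 : GWAP G) * stoneCechToGWAP T y.2 := by
  have h1 : Continuous fun y : G × StoneCech T => stoneCechToGWAP T y.2 :=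
    Continuous.comp continuous_stoneCechToGWAP continuous_snd
  have h2 := Continuous.comp (GWAP.continuous_eval_mul (G := G)) (continuous_fst.prodMk h1)
  exact h2

/-- Both sides are continuous in `r` and agree on the dense copy of `T`, where the product in
`G^WAP` is that of `G`. -/
theorem extend_weightedSum [LocallyCompactSpace G] (hTU : RightUniformlyDiscrete U T)
    (hV : Admissible U V) {φ c : G → ℂ} (hs : Function.support φ ⊆ V * V) {f : WAP G}
    (hf : ∀ s, (f : G →ᵇ ℂ) s = weightedSum T c φ s) {F : StoneCech T → ℂ} (hF : Continuous F)
    (hFc : ∀ t : T, F (stoneCechUnit t) = c t) {v : G} (hv : v ∈ V * V) (r : StoneCech T) :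
    GWAP.extend f (GWAP.eval v * stoneCechToGWAP T r) = F r * φ v := by
  have h0 := Continuous.comp (continuous_eval_mul_stoneCech (T := T))
    (Continuous.prodMk_right v)
  have h1 : Continuous fun r => GWAP.extend f (GWAP.eval v * stoneCechToGWAP T r) :=
    Continuous.comp (GWAP.continuous_extend f) h0
  have h2 : Continuous fun r => F r * φ v := hF.mul continuous_const
  refine congrFun (denseRange_stoneCechUnit.equalizer h1 h2 (funext fun t => ?_)) r
  simp only [Function.comp_apply]
  rw [stoneCechToGWAP_unit, ← GWAP.eval_mul, GWAP.extend_eval, hf,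
    weightedSum_mul (hV.rightUniformlyDiscrete hTU) hs c hv t.2, hFc]

/-- The extension of a weighted sum takes the value `F r * φ v`. Constant coefficients and a bump
`φ` separate `v` from `v'`; a Urysohn function on `βT` as coefficients, with `φ = 1` on the closure
of `V`, separates `r` from `r'`. -/
theorem injOn_eval_mul_stoneCech [LocallyCompactSpace G] (hT : IsESet T)
    (hTU : RightUniformlyDiscrete U T) (hV : Admissible U V) (h : TranslationCompact (V * T))
    {v v' : G} (hv : v ∈ closure V) (hv' : v' ∈ closure V) {r r' : StoneCech T}
    (heq : (GWAP.eval v * stoneCechToGWAP T r : GWAP G) = GWAP.eval v' * stoneCechToGWAP T r') :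
    v = v' ∧ r = r' := by
  classical
  have hclos := hV.closure_subset
  constructor
  · by_contra hne
    obtain ⟨φ, C, hφ, hC, hCV, hs, h1, -⟩ := exists_bump (isCompact_singleton (x := v))
      ((hV.1.mul_left (s := V)).inter (isOpen_compl_singleton (x := v')))
      (singleton_subset_iff.2 ⟨hclos hv, hne⟩)
    have hCV' := hCV.trans inter_subset_left
    obtain ⟨f, hf⟩ := weightedSum_mem_WAPFun hT hTU hV h hφ hC hCV' hs (c := 1) (M := 1)
      (fun t _ => by simp) zero_le_one
    have hval := fun {w : G} (hw : w ∈ closure V) (r : StoneCech T) =>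
      extend_weightedSum hTU hV (hs.trans hCV') hf (F := fun _ => 1) continuous_const
        (fun _ => rfl) (hclos hw) r
    have h2 := hval hv r
    rw [heq, hval hv' r', h1 v rfl, one_mul, one_mul] at h2
    have h3 : v' ∈ Function.support φ := by
      rw [Function.mem_support, h2]
      exact one_ne_zero
    exact (hCV (hs h3)).2 rfl
  · by_contra hne
    obtain ⟨F, hF0, hF1, hF⟩ := exists_continuous_zero_one_of_isClosed
      (isClosed_singleton (x := r)) (isClosed_singleton (x := r')) (by simpa using hne)
    obtain ⟨φ, C, hφ, hC, hCV, hs, h1, -⟩ := exists_bump (K := closure V) hV.2.2.1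
      (hV.1.mul_left (s := V)) hclos
    let c : G → ℂ := fun t => if ht : t ∈ T then (F (stoneCechUnit ⟨t, ht⟩) : ℂ) else 0
    obtain ⟨f, hf⟩ := weightedSum_mem_WAPFun hT hTU hV h hφ hC hCV hs (c := c) (M := 1)
      (fun t ht => by
        simp only [c, dif_pos ht, Complex.norm_real]
        rw [Real.norm_of_nonneg (hF _).1]
        exact (hF _).2) zero_le_one
    have hval := fun {w : G} (hw : w ∈ closure V) (r : StoneCech T) =>
      extend_weightedSum hTU hV (hs.trans hCV) hf (F := fun r => (F r : ℂ))
        (Complex.continuous_ofReal.comp F.continuous) (fun t => by simp [c]) (hclos hw) r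
    have h2 := hval hv r
    rw [heq, hval hv' r', h1 v hv, h1 v' hv', hF0 rfl, hF1 rfl] at h2
    simp at h2

theorem condProduct_of_translationCompact [LocallyCompactSpace G] (hT : IsESet T)
    (hTU : RightUniformlyDiscrete U T) (hV : Admissible U V) (h : TranslationCompact (V * T)) :
    CondProduct T V := by
  refine ⟨isInterpolationSet_of_translationCompact hT hTU hV h, fun φ hφ hs =>
    oneTranslate_mem_WAPFun hT hTU hV h (LUC.continuous hφ) hV.2.2.1 hV.closure_subset hs, ?_⟩
  have : CompactSpace (closure V) := isCompact_iff_compactSpace.1 hV.2.2.1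
  let θ : closure V × StoneCech T →
      ((GWAP.eval '' closure V) * closure (GWAP.eval '' T) : Set (GWAP G)) := fun y =>
    ⟨GWAP.eval (y.1 : G) * stoneCechToGWAP T y.2, _, ⟨y.1, y.1.2, rfl⟩, _,
      range_stoneCechToGWAP.subset (mem_range_self y.2), rfl⟩
  have hcoe : Continuous fun y : closure V × StoneCech T => ((y.1 : G), y.2) :=
    (continuous_subtype_val.comp continuous_fst).prodMk continuous_snd
  have hmul := Continuous.comp (continuous_eval_mul_stoneCech (T := T)) hcoe
  have hθ : Continuous θ := hmul.subtype_mk _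
  have hbij : Function.Bijective θ := by
    constructor
    · rintro ⟨v, r⟩ ⟨v', r'⟩ heq
      obtain ⟨h1, h2⟩ := injOn_eval_mul_stoneCech hT hTU hV h v.2 v'.2 (congrArg Subtype.val heq)
      exact Prod.ext (Subtype.ext h1) h2
    · rintro ⟨_, _, ⟨v, hv, rfl⟩, y, hy, rfl⟩
      rw [← range_stoneCechToGWAP] at hy
      obtain ⟨r, rfl⟩ := hy
      exact ⟨(⟨v, hv⟩, r), rfl⟩
  refine ⟨Continuous.homeoOfEquivCompactToT2 (f := Equiv.ofBijective θ hbij) hθ, fun v t => ?_⟩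
  change GWAP.eval (v : G) * stoneCechToGWAP T (stoneCechUnit t) = _
  rw [stoneCechToGWAP_unit, GWAP.eval_mul]

theorem wapConditions_tfae [LocallyCompactSpace G] (hT : IsESet T)
    (hTU : RightUniformlyDiscrete U T) (hV : Admissible U V) : (wapConditions T V).TFAE := by
  unfold wapConditions
  tfae_have 1 → 2 := translationCompact_of_condUC hT hTU hV
  tfae_have 2 → 1 := condUC_of_translationCompact
  tfae_have 2 → 3 := condVanish_of_translationCompact hT hTU hV
  tfae_have 3 → 2 := fun h =>
    translationCompact_of_closure_subset hV.2.2.1 (closure_subset_of_condVanish hTU hV h)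
  tfae_have 2 → 4 := condOpen_of_translationCompact hT hTU hV
  tfae_have 4 → 2 := fun h => translationCompact_of_closure_subset hV.2.2.1 h.2
  tfae_have 2 → 5 := condProduct_of_translationCompact hT hTU hV
  tfae_have 5 → 2 := translationCompact_of_condProduct hTU hV
  tfae_finish

/-! ### Approximable interpolation sets -/

theorem exists_admissible_of_approximable [LocallyCompactSpace G]
    (hU : U ∈ 𝓝 (1 : G)) (h : IsApproximableInterpolationSet (WAPFun G) T) {N : Set G}
    (hN : N ∈ 𝓝 (1 : G)) : ∃ V ⊆ N, Admissible U V ∧ TranslationCompact (V * T) := by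
  obtain ⟨K, hK, hK1⟩ := exists_compact_mem_nhds (1 : G)
  obtain ⟨V₁, V₂, hV₁, h1, -, -, h12, h2K, hsep⟩ := h.2 K hK1
  -- With `V * V` inside this set, the closure of `V` lies in `V₁`. Hence `V₁` is a neighbourhood of
  -- each of its points, and the approximating functions separate without being translated.
  have hN' : N ∩ (U ∩ V₁) ∈ 𝓝 (1 : G) := inter_mem hN (inter_mem hU (hV₁.mem_nhds h1))
  obtain ⟨V, hV, hV1, hVV⟩ := exists_open_nhds_one_mul_subset hN'
  have hcl := closure_subset_mul_of_isOpen hV hV1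
  have hclV₁ : closure V ⊆ V₁ := fun x hx => (hVV (hcl hx)).2.2
  have hrc : RelativelyCompact V := hK.of_isClosed_subset isClosed_closure
    (hclV₁.trans (subset_closure.trans (h12.trans h2K)))
  refine ⟨V, fun x hx => (hVV (hcl (subset_closure hx))).1,
    ⟨hV, hV1, hrc, fun x hx => (hVV hx).2.1⟩, ?_⟩
  refine translationCompact_of_separation hrc hK fun T₁ hT₁ v hv => ?_
  obtain ⟨g, ⟨f, hf⟩, hg1, hg0⟩ := hsep T₁ hT₁
  refine ⟨f, f.2, V₁, hV₁.mem_nhds (hclV₁ hv), fun s hs => ?_, fun s hs => ?_⟩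
  · rw [hf, hg1 s hs, sub_self, norm_zero]
    norm_num
  · rw [hf, hg0 s fun h => hs (mul_subset_mul_right h2K h), norm_zero]
    norm_num

theorem isApproximable_of_forall_admissible [LocallyCompactSpace G] (hT : IsESet T)
    (hTU : RightUniformlyDiscrete U T)
    (h : ∀ N ∈ 𝓝 (1 : G), ∃ V ⊆ N, Admissible U V ∧ TranslationCompact (V * T)) :
    IsApproximableInterpolationSet (WAPFun G) T := by
  classical
  constructor
  · obtain ⟨V, -, hV, hVT⟩ := h univ univ_mem
    exact isInterpolationSet_of_translationCompact hT hTU hV hVT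
  · intro N hN
    obtain ⟨V, hVN, hV, hVT⟩ := h N hN
    -- The admissible `V` serves as the outer neighbourhood. A bump equal to `1` on the compact
    -- closure of `V₁`, weighted by the indicator of `T₁`, gives the required function.
    obtain ⟨V₁, hV₁, h1, hcl, hc⟩ := exists_open_between_and_isCompact_closure
      (isCompact_singleton (x := (1 : G))) hV.1 (singleton_subset_iff.2 hV.2.1)
    obtain ⟨φ, C, hφ, hC, hCV, hs, hφ1, -⟩ := exists_bump hc hV.1 hcl
    have hCV' := hCV.trans hV.subset_mul
    refine ⟨V₁, V, hV₁, h1 rfl, hV.1, hV.2.1, hcl, hVN, fun T₁ hT₁ => ?_⟩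
    let c : G → ℂ := fun t => if t ∈ T₁ then 1 else 0
    have hval := fun {u t : G} (hu : u ∈ V) (ht : t ∈ T) =>
      weightedSum_mul (hV.rightUniformlyDiscrete hTU) (hs.trans hCV') c (hV.subset_mul hu) ht
    refine ⟨weightedSum T c φ, weightedSum_mem_WAPFun hT hTU hV hVT hφ hC hCV' hs (M := 1)
      (fun t _ => by by_cases ht : t ∈ T₁ <;> simp [c, ht]) zero_le_one, ?_, ?_⟩
    · rintro _ ⟨u, hu, t, ht, rfl⟩
      change weightedSum T c φ (u * t) = 1
      rw [hval (hcl (subset_closure hu)) (hT₁ ht), hφ1 u (subset_closure hu)]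
      simp [c, ht]
    · intro s hs'
      by_cases hsT : s ∈ V * T
      · obtain ⟨u, hu, t, ht, rfl⟩ := hsT
        have ht' : t ∉ T₁ := fun h => hs' ⟨u, hu, t, h, rfl⟩
        change weightedSum T c φ (u * t) = 0
        rw [hval hu ht]
        simp [c, ht']
      · exact weightedSum_eq_zero (hs.trans hCV) c hsT

end Main

theorem mainTheorem1 {G : Type*} [TopologicalSpace G] [Group G] [IsTopologicalGroup G] [T2Space G]
    [LocallyCompactSpace G] (hG : IsEGroup G) (T : Set G) (hT : IsESet T)
    (U : Set G) (hU : U ∈ 𝓝 (1 : G)) (hTU : RightUniformlyDiscrete U T) :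
    (∀ V : Set G, Admissible U V → (wapConditions T V).TFAE) ∧
      [IsApproximableInterpolationSet (WAPFun G) T,
        ∀ N ∈ 𝓝 (1 : G), ∃ V ⊆ N, Admissible U V ∧ ∃ P ∈ wapConditions T V, P,
        ∀ N ∈ 𝓝 (1 : G), ∃ V ⊆ N, Admissible U V ∧ ∀ P ∈ wapConditions T V, P].TFAE := by
  have htfae := fun (V : Set G) (hV : Admissible U V) => wapConditions_tfae hT hTU hV
  have hmem : ∀ V : Set G, TranslationCompact (V * T) ∈ wapConditions T V := fun V => by
    simp [wapConditions, CondTranslationCompact]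
  refine ⟨htfae, ?_⟩
  tfae_have 1 → 3 := by
    intro h N hN
    obtain ⟨V, hVN, hV, hVT⟩ := exists_admissible_of_approximable hU h hN
    exact ⟨V, hVN, hV, fun P hP => (htfae V hV _ (hmem V) P hP).1 hVT⟩
  tfae_have 3 → 2 := by
    intro h N hN
    obtain ⟨V, hVN, hV, hP⟩ := h N hN
    exact ⟨V, hVN, hV, _, hmem V, hP _ (hmem V)⟩
  tfae_have 2 → 1 := by
    intro h
    refine isApproximable_of_forall_admissible hT hTU fun N hN => ?_
    obtain ⟨V, hVN, hV, P, hP, hP'⟩ := h N hN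
    exact ⟨V, hVN, hV, (htfae V hV P hP _ (hmem V)).1 hP'⟩
  tfae_finish
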